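/- Let $d\ge 1$ and let $\Omega\subset\mathbb R^d$ (the treated region) be closed and bounded with piecewise smooth boundary: $\Omega$ is the closure of its interior, and $\partial\Omega$ is a finite union of smooth patches $\varphi_j(K_j)$, where $K_j\subset\mathbb R^{d-1}$ is compact with Lebesgue-null frontier, $\varphi_j$ is smooth near $K_j$ and an immersion on the interior of $K_j$, and no point of $\varphi_j(\operatorname{int}K_j)$ is attained at any other parameter value, in the same or another patch. Let $g_\Omega(x)=\operatorname{dist}(x,\partial\Omega)$ for $x\in\Omega$ and $g_\Omega(x)=-\operatorname{dist}(x,\partial\Omega)$ for $x\notin\Omega$. Let $X$ be a bounded random vector in $\mathbb R^d$ with support $\mathbb X$ and Lebesgue density $f_X$ that is continuous at every point of $\partial\Omega$. Let $Y(0),Y(1)$ be integrable real random variables (potential outcomes), and assume that the observed outcome $Y=T\,Y(1)+(1-T)\,Y(0)$, with $T=\mathbf 1\{X\in\Omega\}$, is bounded. Put $g=g_\Omega(X)$ and let $f_g$ be a density of $g$. Assume that $f_g$ is bounded away from zero (almost everywhere) in some neighborhood of $0$, and that for $t\in\{0,1\}$ the regression function $x\mapsto\mathbb E[Y(t)\mid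 X=x]$ is twice continuously differentiable and bounded on $\mathbb X$. Let $\tau(x)=\mathbb E[Y(1)-Y(0)\mid X=x]$, in its version continuous on $\mathbb X$. Since densities and conditional expectations given $g$ are determined only almost everywhere, limits in $\epsilon$ are taken up to Lebesgue-null sets of $\epsilon$, for arbitrary versions. Then the one-sided limits $\lim_{\epsilon\to0^\pm}\mathbb E[Y\mid g=\epsilon]$ exist, the limit $f_g(0):=\lim_{\epsilon\to0}f_g(\epsilon)$ exists and is positive, $\tau f_X$ is integrable over $\partial\Omega$, and \[ \lim_{\epsilon\to0^+}\mathbb E[Y\mid g=\epsilon]-\lim_{\epsilon\to0^-}\mathbb E[Y\mid g=\epsilon] =\frac1{f_g(0)}\int_{\partial\Omega}\tau(x)\,f_X(x)\,dS(x), \] where $dS$ is the $(d-1)$-dimensional Hausdorff measure, normalized to be surface area. Moreover $f_g(0)=\int_{\partial\Omega}f_X\,dS$, so the jump is a density-weighted average of the boundary treatment effects $\tau(x)$. -/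

import Mathlib

open MeasureTheory Filter Topology Set
open scoped ContDiff

namespace BoundaryRD

/-- `Ω ⊆ ℝⁿ⁺¹` has a piecewise smooth boundary: `Ω` is the closure of its interior (so that it lies
on one side of its boundary), and `∂Ω` is a finite union of smooth patches `φ j (K j)`. Here `K j` is
a compact subset of `ℝⁿ` whose frontier is Lebesgue-null, `φ j` is smooth (a map that is smooth near
the compact set `K j` can always be taken to be smooth on all of `ℝⁿ`) and is an immersion on the
interior of `K j`. Patches may meet each other or themselves only along the images of the frontiers
of their parameter sets (edges, corners, cone points, seams). -/
def HasPiecewiseSmoothBoundary {n : ℕ} (Ω : Set (EuclideanSpace ℝ (Fin (n + 1)))) : Prop :=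
  closure (interior Ω) = Ω ∧
  ∃ (k : ℕ) (K : Fin k → Set (EuclideanSpace ℝ (Fin n)))
    (φ : Fin k → EuclideanSpace ℝ (Fin n) → EuclideanSpace ℝ (Fin (n + 1))),
    (∀ j, IsCompact (K j)) ∧
    (∀ j, volume (frontier (K j)) = 0) ∧
    (∀ j, ContDiff ℝ ∞ (φ j)) ∧
    (∀ j, ∀ u ∈ interior (K j), Function.Injective (fderiv ℝ (φ j) u)) ∧
    (∀ i j, ∀ u ∈ interior (K i), ∀ v ∈ K j, φ i u = φ j v → i = j ∧ u = v) ∧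
    frontier Ω = ⋃ j, φ j '' K j

open Classical in
/-- The signed Euclidean distance to `∂Ω`: nonnegative on `Ω`, nonpositive off `Ω`. -/
noncomputable def signedDistance {n : ℕ} (Ω : Set (EuclideanSpace ℝ (Fin (n + 1))))
    (x : EuclideanSpace ℝ (Fin (n + 1))) : ℝ :=
  if x ∈ Ω then Metric.infDist x (frontier Ω) else -Metric.infDist x (frontier Ω)

open Classical in
/-- The observed outcome `Y = T Y(1) + (1 - T) Y(0)`, where `T = 1` if `X ∈ Ω` and `T = 0`
otherwise. -/
noncomputable def observedOutcome {S E : Type*} (Ω : Set E) (X : S → E) (Y : Fin 2 → S → ℝ)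
    (s : S) : ℝ :=
  if X s ∈ Ω then Y 1 s else Y 0 s

/-- `m` is a version of the regression function `z ↦ 𝔼[W ∣ Z = z]`. -/
def IsRegressionFunction {S Z : Type*} [MeasurableSpace S] [mZ : MeasurableSpace Z]
    (P : Measure S) (W : S → ℝ) (V : S → Z) (m : Z → ℝ) : Prop :=
  Measurable m ∧ (fun s => m (V s)) =ᵐ[P] P[W | mZ.comap V]

/-- `f` is a (version of the) Lebesgue density of the law of the random element `V`. -/
def IsDensity {S Z : Type*} [MeasurableSpace S] [MeasureSpace Z]
    (P : Measure S) (V : S → Z) (f : Z → ℝ) : Prop :=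
  Measurable f ∧ (∀ z, 0 ≤ f z) ∧
    P.map V = (volume : Measure Z).withDensity (fun z => ENNReal.ofReal (f z))

/-- `h` tends to `L` at `0` from within `A`, up to a Lebesgue-null set of arguments. This is the
notion of limit that applies to functions determined only almost everywhere (densities, conditional
expectations); it agrees with the usual limit, for `A` one of `ℝ`, `(0, ∞)`, `(-∞, 0)`, whenever
the latter exists. -/
def HasEssLimitAtZero (h : ℝ → ℝ) (A : Set ℝ) (L : ℝ) : Prop :=
  Tendsto h (𝓝[A] (0 : ℝ) ⊓ ae volume) (𝓝 L)

end BoundaryRD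

open BoundaryRD

/-! Heuristically, on one side of D = ∂Ω the density at ε of the distance to D, weighted by f, is
the integral of f over the parallel surface at distance ε, and this tends to the integral of f over
D. Edges and corners rule out tubular coordinates, and the limit is needed for almost every ε, not
merely on average. Two facts replace the coordinates.

First, on average: outside a set of small parameter measure, D is locally the graph of a Lipschitz
function with constant as small as desired. Hence the slab where the distance lies in (aε, ε) has
volume (1 - a) H(D) ε + o(ε) on each side, H being surface area. The exceptional part is a finite
union of Lipschitz images of small sets, so its neighbourhoods are small compared with ε
(`volume_cthickening_image_le`).

Second, from averages to almost every ε: pulling points towards their nearest points of D by a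
factor 1/l shrinks volume at most by l ^ (n + 1). This is Kneser's property (`volume_nearSet_le`).
It bounds the law ρ of the distance by ρ(B) ≤ l ^ (n + 1) ρ(B / l) for every Borel set B, so slab
averages control the density up to factors that tend to 1 as a → 1 (`measure_le_of_dilation`,
`le_measure_of_dilation`).

The upper bound localizes to points whose nearest point lies in a closed C ⊆ D. Applied to
superlevel sets of f it bounds integrals of f from above. Applied to b + f and b - f, with the lower
bound for the total volume, it gives both directions (`IsSide.exists_integral_approx`).

On the probabilistic side, E[Y ∣ g = ·] times the density of g has, over B, the same integral as
E[Y(t) ∣ X = ·] f_X over the points with signed distance in B, where t = 1 inside and t = 0 outside.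
So this product tends to the surface integral of E[Y(t) ∣ X = x] f_X(x) at 0±. The constant outcome
1 yields the limit of f_g. The formula follows by dividing and subtracting. -/

namespace BoundaryRD

/-! ### Lipschitz images: Hausdorff measure and volume of neighbourhoods -/

open scoped ENNReal NNReal

/-- Euclidean space of dimension `n`. -/
abbrev Eucl (n : ℕ) := EuclideanSpace ℝ (Fin n)

theorem euclideanHausdorffMeasure_image_le {V W : Type*} [EMetricSpace V] [MeasurableSpace V]
    [BorelSpace V] [EMetricSpace W] [MeasurableSpace W] [BorelSpace W] {f : V → W} {s : Set V}
    {K : ℝ≥0} (h : LipschitzOnWith K f s) (d : ℕ) :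
    μHE[d] (f '' s) ≤ (K : ℝ≥0∞) ^ d * μHE[d] s := by
  have := h.hausdorffMeasure_image_le (d := d) (by positivity)
  rw [ENNReal.rpow_natCast] at this
  simp only [Measure.euclideanHausdorffMeasure_def, Measure.smul_apply, ENNReal.smul_def,
    smul_eq_mul]
  rw [mul_left_comm]
  gcongr

/-- If `T` contracts distances on `s` by at most a factor `K`, then it contracts volume by at most
the factor `K ^ d`. -/
theorem volume_le_of_dist_le {d : ℕ} {T : Eucl d → Eucl d} {s : Set (Eucl d)} {K : ℝ≥0}
    (h : ∀ x ∈ s, ∀ y ∈ s, dist x y ≤ K * dist (T x) (T y)) :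
    volume s ≤ (K : ℝ≥0∞) ^ d * volume (T '' s) := by
  rcases s.eq_empty_or_nonempty with rfl | hne
  · simp
  have hinj : InjOn T s := by
    intro x hx y hy hxy
    have := h x hx y hy
    rw [hxy, dist_self, mul_zero] at this
    exact dist_le_zero.1 this
  have : Nonempty (Eucl d) := inferInstance
  have hlip : LipschitzOnWith K (Function.invFunOn T s) (T '' s) := by
    apply LipschitzOnWith.of_dist_le_mul
    rintro _ ⟨x, hx, rfl⟩ _ ⟨y, hy, rfl⟩
    rw [hinj.leftInvOn_invFunOn hx, hinj.leftInvOn_invFunOn hy]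
    exact h x hx y hy
  have := euclideanHausdorffMeasure_image_le hlip d
  rwa [hinj.leftInvOn_invFunOn.image_image, EuclideanSpace.euclideanHausdorffMeasure_eq_volume]
    at this

theorem exists_dist_le_of_mem_cthickening {V : Type*} [PseudoMetricSpace V] {A : Set V}
    (hA : IsCompact A) {ε : ℝ} (hε : 0 ≤ ε) {x : V} (hx : x ∈ Metric.cthickening ε A) :
    ∃ a ∈ A, dist x a ≤ ε := by
  rw [hA.cthickening_eq_biUnion_closedBall hε] at hx
  simpa using hx

/-- Double counting of pairs (x, u) with x near φ(A), u near A and x within (1 + L) ε of φ(u). Every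
x has at least an ε-ball of partners, around a parameter of a nearby point of φ(A). Every u has at
most a ball of radius (1 + L) ε of partners. -/
theorem volume_cthickening_image_le_aux {n : ℕ} {φ : Eucl n → Eucl (n + 1)} {L : ℝ≥0}
    (hφ : LipschitzWith L φ) {A : Set (Eucl n)} (hA : IsCompact A) {ε : ℝ} (hε : 0 < ε) :
    volume (Metric.closedBall (0 : Eucl n) ε) * volume (Metric.cthickening ε (φ '' A)) ≤
      volume (Metric.closedBall (0 : Eucl (n + 1)) ((1 + L) * ε)) *
        volume (Metric.cthickening ε A) := by
  set Z : Set (Eucl (n + 1) × Eucl n) :=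
    {z | z.1 ∈ Metric.cthickening ε (φ '' A) ∧ z.2 ∈ Metric.cthickening ε A ∧
      dist z.1 (φ z.2) ≤ (1 + L) * ε} with hZ
  have hZm : MeasurableSet Z := by
    apply IsClosed.measurableSet
    refine (Metric.isClosed_cthickening.preimage continuous_fst).inter
      ((Metric.isClosed_cthickening.preimage continuous_snd).inter
        (isClosed_le (continuous_fst.dist (hφ.continuous.comp continuous_snd)) continuous_const))
  have h1 : volume (Metric.closedBall (0 : Eucl n) ε) * volume (Metric.cthickening ε (φ '' A)) ≤
      (volume.prod volume) Z := by
    rw [Measure.prod_apply hZm, ← setLIntegral_const]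
    refine (setLIntegral_mono' Metric.isClosed_cthickening.measurableSet ?_).trans
      (setLIntegral_le_lintegral _ _)
    intro x hx
    obtain ⟨_, ⟨a, ha, rfl⟩, hxa⟩ :=
      exists_dist_le_of_mem_cthickening (hA.image hφ.continuous) hε.le hx
    rw [← Measure.addHaar_closedBall_center volume a]
    refine measure_mono fun u hu => ⟨hx, Metric.mem_cthickening_of_dist_le _ _ _ _ ha hu, ?_⟩
    have h2 : dist (φ a) (φ u) ≤ L * ε :=
      (hφ.dist_le_mul a u).trans (by
        gcongr; rw [dist_comm]; exact hu)
    calc dist x (φ u) ≤ dist x (φ a) + dist (φ a) (φ u) := dist_triangle _ _ _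
      _ ≤ (1 + L) * ε := by linarith
  refine h1.trans ?_
  rw [Measure.prod_apply_symm hZm, ← setLIntegral_const,
    ← lintegral_indicator Metric.isClosed_cthickening.measurableSet]
  refine lintegral_mono fun u => ?_
  by_cases hu : u ∈ Metric.cthickening ε A
  · rw [indicator_of_mem hu, ← Measure.addHaar_closedBall_center volume (φ u)]
    exact measure_mono fun x hx => hx.2.2
  · rw [indicator_of_notMem hu]
    refine (measure_mono_null (fun x hx => ?_) measure_empty).le
    exact hu hx.2.1

/-- The constant in the upper Minkowski content bound for Lipschitz images. -/
noncomputable def contentConst (n : ℕ) (L : ℝ≥0) : ℝ≥0∞ :=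
  ENNReal.ofReal ((1 + L) ^ (n + 1)) * volume (Metric.closedBall (0 : Eucl (n + 1)) 1) /
    volume (Metric.closedBall (0 : Eucl n) 1)

theorem volume_closedBall_ne_zero {d : ℕ} : volume (Metric.closedBall (0 : Eucl d) 1) ≠ 0 :=
  (Metric.measure_closedBall_pos _ _ one_pos).ne'

theorem volume_closedBall_ne_top {d : ℕ} : volume (Metric.closedBall (0 : Eucl d) 1) ≠ ⊤ :=
  measure_closedBall_lt_top.ne

theorem contentConst_ne_top (n : ℕ) (L : ℝ≥0) : contentConst n L ≠ ⊤ :=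
  ENNReal.div_ne_top (ENNReal.mul_ne_top ENNReal.ofReal_ne_top volume_closedBall_ne_top)
    volume_closedBall_ne_zero

/-- The balls in the double count have dimensions n + 1 and n, so exactly one factor ε survives the
division. -/
theorem volume_cthickening_image_le {n : ℕ} {φ : Eucl n → Eucl (n + 1)} {L : ℝ≥0}
    (hφ : LipschitzWith L φ) {A : Set (Eucl n)} (hA : IsCompact A) {ε : ℝ} (hε : 0 < ε) :
    volume (Metric.cthickening ε (φ '' A)) ≤
      contentConst n L * volume (Metric.cthickening ε A) * ENNReal.ofReal ε := by
  have h := volume_cthickening_image_le_aux hφ hA hε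
  rw [Measure.addHaar_closedBall' _ _ hε.le,
    Measure.addHaar_closedBall' _ _ (r := (1 + L) * ε) (by positivity)] at h
  simp only [finrank_euclideanSpace_fin] at h
  have e : ENNReal.ofReal (((1 + L) * ε) ^ (n + 1)) =
      ENNReal.ofReal (ε ^ n) * (ENNReal.ofReal ε * ENNReal.ofReal ((1 + L) ^ (n + 1))) := by
    rw [← ENNReal.ofReal_mul hε.le, ← ENNReal.ofReal_mul (by positivity)]
    congr 1; rw [mul_pow, pow_succ ε]; ring
  rw [e, mul_assoc, mul_assoc, mul_assoc] at h
  have h0 : ENNReal.ofReal (ε ^ n) ≠ 0 := by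
    simpa using pow_pos hε n
  rw [ENNReal.mul_le_mul_iff_right h0 ENNReal.ofReal_ne_top] at h
  rw [contentConst, ENNReal.div_eq_inv_mul]
  refine le_trans (b := (volume (Metric.closedBall (0 : Eucl n) 1))⁻¹ *
    (ENNReal.ofReal ε * (ENNReal.ofReal ((1 + L) ^ (n + 1)) *
      (volume (Metric.closedBall (0 : Eucl (n + 1)) 1) * volume (Metric.cthickening ε A)))))
    ?_ (le_of_eq (by ring))
  rw [← ENNReal.mul_le_iff_le_inv volume_closedBall_ne_zero volume_closedBall_ne_top]
  convert h using 1
  ring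

theorem eventually_volume_cthickening_image_le {n : ℕ} {φ : Eucl n → Eucl (n + 1)} {L : ℝ≥0}
    (hφ : LipschitzWith L φ) {A : Set (Eucl n)} (hA : IsCompact A) {c : ℝ≥0∞}
    (hc : contentConst n L * volume A < c) :
    ∀ᶠ ε in 𝓝[>] (0 : ℝ), volume (Metric.cthickening ε (φ '' A)) ≤ c * ENNReal.ofReal ε := by
  have h1 : Tendsto (fun ε => contentConst n L * volume (Metric.cthickening ε A)) (𝓝[>] 0)
      (𝓝 (contentConst n L * volume A)) :=
    (ENNReal.Tendsto.const_mul (tendsto_measure_cthickening_of_isCompact hA)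
      (Or.inr (contentConst_ne_top n L))).mono_left nhdsWithin_le_nhds
  filter_upwards [h1.eventually (gt_mem_nhds hc), self_mem_nhdsWithin] with ε h2 hε
  exact (volume_cthickening_image_le hφ hA hε).trans (by gcongr)

end BoundaryRD

/-! ### Kneser's property: contraction towards nearest points -/

namespace BoundaryRD

open scoped ENNReal NNReal RealInnerProductSpace

/-- The points that have a nearest point of `D` in `C`. -/
def nearSet {V : Type*} [PseudoMetricSpace V] (D C : Set V) : Set V :=
  {x | ∃ q ∈ C, dist x q = Metric.infDist x D}

theorem isClosed_nearSet {V : Type*} [PseudoMetricSpace V] {D C : Set V}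
    (hC : IsCompact C) (hCD : C ⊆ D) : IsClosed (nearSet D C) := by
  rcases C.eq_empty_or_nonempty with rfl | hne
  · convert isClosed_empty
    simp [nearSet]
  have : nearSet D C = {x | Metric.infDist x C ≤ Metric.infDist x D} := by
    ext x
    constructor
    · rintro ⟨q, hq, h⟩
      exact (Metric.infDist_le_dist_of_mem hq).trans h.le
    · intro h
      obtain ⟨q, hq, e⟩ := hC.exists_infDist_eq_dist hne x
      exact ⟨q, hq, e ▸ le_antisymm h (Metric.infDist_le_infDist_of_subset hCD hne)⟩
  rw [this]
  exact isClosed_le (Metric.continuous_infDist_pt _) (Metric.continuous_infDist_pt _)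

/-- The contraction towards nearest points does not contract distances too much. -/
theorem norm_sub_le_of_nearest {H : Type*} [NormedAddCommGroup H] [InnerProductSpace ℝ H]
    {x y p q : H} {l : ℝ} (hl : 1 ≤ l) (hx : ‖x - p‖ ≤ ‖x - q‖) (hy : ‖y - q‖ ≤ ‖y - p‖) :
    ‖x - y‖ ≤ l * ‖(p + l⁻¹ • (x - p)) - (q + l⁻¹ • (y - q))‖ := by
  have hl0 : 0 < l := by linarith
  -- Scaled by l, the difference of the contracted points is x - y plus a multiple of p - q, a
  -- vector at a non-obtuse angle to x - y.
  have e : x - y + (l - 1) • (p - q) = l • ((p + l⁻¹ • (x - p)) - (q + l⁻¹ • (y - q))) := by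
    simp only [smul_sub, smul_add, smul_smul, mul_inv_cancel₀ hl0.ne', one_smul, sub_smul]
    abel
  have e2 : l * ‖(p + l⁻¹ • (x - p)) - (q + l⁻¹ • (y - q))‖ = ‖x - y + (l - 1) • (p - q)‖ := by
    rw [e, norm_smul, Real.norm_of_nonneg hl0.le]
  rw [e2]
  -- Adding the squares of `hx` and `hy` cancels all the squared norms and leaves twice this inner
  -- product.
  have hin : 0 ≤ ⟪x - y, p - q⟫ := by
    have h1 : ‖x - p‖ ^ 2 ≤ ‖x - q‖ ^ 2 := by gcongr
    have h2 : ‖y - q‖ ^ 2 ≤ ‖y - p‖ ^ 2 := by gcongr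
    simp only [← real_inner_self_eq_norm_sq, inner_sub_left, inner_sub_right] at h1 h2 ⊢
    simp only [real_inner_comm p x, real_inner_comm q x, real_inner_comm p y,
      real_inner_comm q y] at h1 h2 ⊢
    linarith
  refine le_of_sq_le_sq ?_ (norm_nonneg _)
  rw [norm_add_sq_real, real_inner_smul_right]
  have : 0 ≤ (l - 1) * ⟪x - y, p - q⟫ := mul_nonneg (by linarith) hin
  nlinarith [sq_nonneg ‖(l - 1) • (p - q)‖]

/-- The triangle inequality forbids the distance to drop faster than the path travelled, so q stays
nearest along the whole segment from q to x. -/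
theorem infDist_nearest_homothety {H : Type*} [NormedAddCommGroup H] [NormedSpace ℝ H]
    {D : Set H} {x q : H} (hq : q ∈ D) (h : dist x q = Metric.infDist x D) {t : ℝ}
    (ht0 : 0 ≤ t) (ht1 : t ≤ 1) :
    Metric.infDist (q + t • (x - q)) D = t * Metric.infDist x D ∧
      dist (q + t • (x - q)) q = t * Metric.infDist x D := by
  have h1 : dist (q + t • (x - q)) q = t * Metric.infDist x D := by
    rw [← h, dist_eq_norm, dist_eq_norm, add_sub_cancel_left, norm_smul, Real.norm_of_nonneg ht0]
  refine ⟨le_antisymm (h1 ▸ Metric.infDist_le_dist_of_mem hq) ?_, h1⟩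
  have h2 : dist x (q + t • (x - q)) = (1 - t) * Metric.infDist x D := by
    rw [← h, dist_eq_norm, dist_eq_norm]
    have : x - (q + t • (x - q)) = (1 - t) • (x - q) := by
      rw [sub_smul, one_smul]; abel
    rw [this, norm_smul, Real.norm_of_nonneg (by linarith)]
  have := Metric.infDist_le_infDist_add_dist (s := D) (x := x) (y := q + t • (x - q))
  linarith

/-- An open set whose frontier is avoided by a preconnected set that meets it contains the latter. -/
theorem subset_of_disjoint_frontier {V : Type*} [TopologicalSpace V] {S D t : Set V}
    (hS : IsOpen S) (ht : IsPreconnected t) (hfr : frontier S ⊆ D) (htD : Disjoint t D) (hne : (t ∩ S).Nonempty) :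
    t ⊆ S := by
  refine ht.subset_left_of_subset_union hS isClosed_closure.isOpen_compl
    (disjoint_compl_right.mono_left subset_closure |>.mono_right subset_rfl) (fun z hz => ?_) hne
  by_cases h : z ∈ closure S
  · refine Or.inl (by_contra fun hzS => disjoint_left.1 htD hz (hfr ⟨h, ?_⟩))
    rwa [hS.interior_eq]
  · exact Or.inr h

/-- Kneser's property of the parallel sets of `D`, localized to one side `S` of `D` and to the
points whose nearest point of `D` lies in `C`. -/
theorem volume_nearSet_le {d : ℕ} {D S C : Set (Eucl d)} (hS : IsOpen S)
    (hSD : Disjoint S D) (hfr : frontier S ⊆ D) (hD : IsClosed D) (hCD : C ⊆ D) {l : ℝ} (hl : 1 ≤ l) {B : Set ℝ} :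
    volume (S ∩ nearSet D C ∩ (Metric.infDist · D) ⁻¹' B) ≤ ENNReal.ofReal l ^ d *
      volume (S ∩ nearSet D C ∩ (Metric.infDist · D) ⁻¹' ((l * ·) ⁻¹' B)) := by
  have hl0 : 0 < l := by linarith
  choose! q hqC hq using fun (x : Eucl d) (hx : x ∈ nearSet D C) => hx
  set Z := S ∩ nearSet D C ∩ (Metric.infDist · D) ⁻¹' B
  have key := volume_le_of_dist_le (T := fun x => q x + l⁻¹ • (x - q x)) (s := Z)
    (K := l.toNNReal) (by
      intro x hx y hy
      rw [dist_eq_norm, dist_eq_norm, Real.coe_toNNReal _ hl0.le]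
      have hx' := hq x hx.1.2
      have hy' := hq y hy.1.2
      apply norm_sub_le_of_nearest hl
      · rw [← dist_eq_norm, ← dist_eq_norm, hx']
        exact Metric.infDist_le_dist_of_mem (hCD (hqC y hy.1.2))
      · rw [← dist_eq_norm, ← dist_eq_norm, hy']
        exact Metric.infDist_le_dist_of_mem (hCD (hqC x hx.1.2)))
  refine key.trans ?_
  gcongr
  · exact le_rfl
  rintro _ ⟨x, hx, rfl⟩
  have hqD := hCD (hqC x hx.1.2)
  have hd : 0 < Metric.infDist x D :=
    (hD.notMem_iff_infDist_pos ⟨_, hqD⟩).1 (disjoint_left.1 hSD hx.1.1)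
  have hinv : l⁻¹ ≤ 1 := inv_le_one_of_one_le₀ hl
  obtain ⟨h1, h2⟩ := infDist_nearest_homothety hqD (hq x hx.1.2) (inv_nonneg.2 hl0.le) hinv
  refine ⟨⟨?_, q x, hqC x hx.1.2, by rw [h1, h2]⟩, ?_⟩
  -- The segment from x to its image has positive distance to D throughout, hence cannot leave S.
  · have hseg : IsPreconnected ((fun t : ℝ => q x + t • (x - q x)) '' Icc l⁻¹ 1) :=
      isPreconnected_Icc.image _ (by fun_prop)
    refine (subset_of_disjoint_frontier hS hseg hfr ?_ ?_)
      ⟨l⁻¹, left_mem_Icc.2 hinv, rfl⟩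
    · rw [disjoint_left]
      rintro _ ⟨t, ht, rfl⟩ htD
      have ht0 : 0 < t := (inv_pos.2 hl0).trans_le ht.1
      have h3 := (infDist_nearest_homothety hqD (hq x hx.1.2) ht0.le ht.2).1
      rw [Metric.infDist_zero_of_mem htD] at h3
      exact (mul_pos ht0 hd).ne h3
    · exact ⟨x, ⟨1, right_mem_Icc.2 hinv, by simp⟩, hx.1.1⟩
  · simp only [mem_preimage]
    rw [h1, mul_inv_cancel_left₀ hl0.ne']
    exact hx.2

end BoundaryRD

/-! ### Measures on the half line with controlled growth under dilation -/

namespace BoundaryRD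

open scoped ENNReal NNReal

theorem indicator_eq_of_mem_iff {α β M : Type*} [Zero M] {s : Set α} {t : Set β} {f : α → M}
    {g : β → M} {a : α} {b : β} (h : a ∈ s ↔ b ∈ t) (hfg : f a = g b) :
    s.indicator f a = t.indicator g b := by
  by_cases ha : a ∈ s
  · rw [indicator_of_mem ha, indicator_of_mem (h.1 ha), hfg]
  · rw [indicator_of_notMem ha, indicator_of_notMem (mt h.2 ha)]

/-- Tonelli and the substitution y = l x, in which dl = dy / x for fixed x. Points x ≤ 0 contribute
to neither side because B is positive. -/
theorem lintegral_measure_dilation {ρ : Measure ℝ} [SFinite ρ] {α β : ℝ} (hα : 0 < α)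
    (hβ : 0 < β) {B : Set ℝ} (hB : MeasurableSet B) (hB0 : B ⊆ Ioi 0) :
    ∫⁻ l in Ioo α β, ρ ((l * ·) ⁻¹' B) =
      ∫⁻ y in B, ∫⁻ x in Ioo (y / β) (y / α), ENNReal.ofReal x⁻¹ ∂ρ := by
  have hF : MeasurableSet {z : ℝ × ℝ | z.1 ∈ Ioo α β ∧ z.1 * z.2 ∈ B} :=
    (measurable_fst measurableSet_Ioo).inter ((measurable_fst.mul measurable_snd) hB)
  have hG : MeasurableSet {z : ℝ × ℝ | z.1 ∈ B ∧ z.2 ∈ Ioo (z.1 / β) (z.1 / α)} :=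
    (measurable_fst hB).inter ((measurableSet_lt (measurable_fst.div_const _) measurable_snd).inter
      (measurableSet_lt measurable_snd (measurable_fst.div_const _)))
  have e1 : ∫⁻ l in Ioo α β, ρ ((l * ·) ⁻¹' B) = ∫⁻ l, ∫⁻ x,
      {z : ℝ × ℝ | z.1 ∈ Ioo α β ∧ z.1 * z.2 ∈ B}.indicator 1 (l, x) ∂ρ := by
    rw [← lintegral_indicator measurableSet_Ioo]
    refine lintegral_congr fun l => ?_
    by_cases hl : l ∈ Ioo α β
    · rw [indicator_of_mem hl, ← lintegral_indicator_one ((measurable_const_mul l) hB)]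
      refine lintegral_congr fun x => ?_
      exact indicator_eq_of_mem_iff (by simp [hl.1, hl.2]) rfl
    · simp [hl, indicator]
  have e2 : ∫⁻ y in B, ∫⁻ x in Ioo (y / β) (y / α), ENNReal.ofReal x⁻¹ ∂ρ = ∫⁻ y, ∫⁻ x,
      {z : ℝ × ℝ | z.1 ∈ B ∧ z.2 ∈ Ioo (z.1 / β) (z.1 / α)}.indicator
        (fun z => ENNReal.ofReal z.2⁻¹) (y, x) ∂ρ := by
    rw [← lintegral_indicator hB]
    refine lintegral_congr fun y => ?_
    by_cases hy : y ∈ B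
    · rw [indicator_of_mem hy, ← lintegral_indicator measurableSet_Ioo]
      refine lintegral_congr fun x => ?_
      exact indicator_eq_of_mem_iff (by simp [hy]) rfl
    · simp [hy, indicator]
  rw [e1, e2, lintegral_lintegral_swap (f := fun l x =>
      {z : ℝ × ℝ | z.1 ∈ Ioo α β ∧ z.1 * z.2 ∈ B}.indicator (1 : ℝ × ℝ → ℝ≥0∞) (l, x))
      ((measurable_one.indicator hF).aemeasurable),
    lintegral_lintegral_swap (f := fun y x =>
      {z : ℝ × ℝ | z.1 ∈ B ∧ z.2 ∈ Ioo (z.1 / β) (z.1 / α)}.indicator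
        (fun z => ENNReal.ofReal z.2⁻¹) (y, x))
      (((by fun_prop : Measurable fun z : ℝ × ℝ =>
        ENNReal.ofReal z.2⁻¹).indicator hG).aemeasurable)]
  refine lintegral_congr fun x => ?_
  rcases le_or_gt x 0 with hx | hx
  · have h1 : ∀ l, (l, x) ∉ {z : ℝ × ℝ | z.1 ∈ Ioo α β ∧ z.1 * z.2 ∈ B} := by
      rintro l ⟨hl, hlx⟩
      exact (mul_nonpos_of_nonneg_of_nonpos (hα.trans hl.1).le hx).not_gt (hB0 hlx)
    have h2 : ∀ y, (y, x) ∉ {z : ℝ × ℝ | z.1 ∈ B ∧ z.2 ∈ Ioo (z.1 / β) (z.1 / α)} := by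
      rintro y ⟨hy, hyx⟩
      exact hx.not_gt ((div_pos (hB0 hy) hβ).trans hyx.1)
    simp only [indicator_of_notMem (h1 _), indicator_of_notMem (h2 _)]
  · have hBx : MeasurableSet (B ∩ Ioo (α * x) (β * x)) := hB.inter measurableSet_Ioo
    have h1 : ∀ l, {z : ℝ × ℝ | z.1 ∈ Ioo α β ∧ z.1 * z.2 ∈ B}.indicator (1 : ℝ × ℝ → ℝ≥0∞) (l, x) =
        ((x * ·) ⁻¹' (B ∩ Ioo (α * x) (β * x))).indicator 1 l := by
      intro l
      refine indicator_eq_of_mem_iff ?_ rfl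
      simp only [mem_ofPred_eq, mem_preimage, mem_inter_iff, mem_Ioo, mul_comm x l,
        mul_lt_mul_iff_left₀ hx, and_comm]
    have h2 : ∀ y, {z : ℝ × ℝ | z.1 ∈ B ∧ z.2 ∈ Ioo (z.1 / β) (z.1 / α)}.indicator
        (fun z => ENNReal.ofReal z.2⁻¹) (y, x) =
        (B ∩ Ioo (α * x) (β * x)).indicator (fun _ => ENNReal.ofReal x⁻¹) y := by
      intro y
      refine indicator_eq_of_mem_iff ?_ rfl
      simp only [mem_ofPred_eq, mem_inter_iff, mem_Ioo, div_lt_iff₀ hβ, lt_div_iff₀ hα,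
        mul_comm x, and_comm]
    simp only [h1, h2]
    rw [lintegral_indicator_one ((measurable_const_mul x) hBx), lintegral_indicator hBx,
      setLIntegral_const, Real.volume_preimage_mul_left hx.ne', abs_of_pos (inv_pos.2 hx)]

/-- A measure on the half line which grows at most like `t ^ d` under dilation is bounded by
its averages over intervals. -/
theorem measure_le_of_dilation {ρ : Measure ℝ} [SFinite ρ] {d : ℕ}
    (hρ : ∀ l : ℝ, 1 ≤ l → ∀ B : Set ℝ, MeasurableSet B → B ⊆ Ioi 0 →
      ρ B ≤ ENNReal.ofReal l ^ d * ρ ((l * ·) ⁻¹' B))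
    {a ε₀ : ℝ} (ha0 : 0 < a) (ha1 : a < 1) {c : ℝ≥0∞}
    (h : ∀ ε ∈ Ioo 0 ε₀, ρ (Ioo (a * ε) ε) ≤ c * ENNReal.ofReal ε)
    {B : Set ℝ} (hB : MeasurableSet B) (hB0 : B ⊆ Ioo 0 ε₀) :
    ENNReal.ofReal ((1 - a) * a ^ d) * ρ B ≤ c * volume B := by
  have hBpos : B ⊆ Ioi 0 := fun x hx => (hB0 hx).1
  -- The growth hypothesis averaged over l in (1, 1/a), where (a l) ^ d ≤ 1.
  have h1 : ENNReal.ofReal (a⁻¹ - 1) * (ENNReal.ofReal (a ^ d) * ρ B) ≤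
      ∫⁻ l in Ioo 1 a⁻¹, ρ ((l * ·) ⁻¹' B) := by
    rw [mul_comm, ← Real.volume_Ioo, ← setLIntegral_const]
    refine setLIntegral_mono' measurableSet_Ioo fun l hl => ?_
    refine (mul_le_mul_right (hρ l hl.1.le B hB hBpos) _).trans ?_
    rw [← mul_assoc, ← ENNReal.ofReal_pow (by linarith [hl.1]), ← ENNReal.ofReal_mul (by positivity),
      ← mul_pow]
    refine mul_le_of_le_one_left zero_le ?_
    rw [ENNReal.ofReal_le_one]
    refine pow_le_one₀ (mul_nonneg ha0.le (by linarith [hl.1])) ?_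
    have := mul_le_mul_of_nonneg_left hl.2.le ha0.le
    rwa [mul_inv_cancel₀ ha0.ne'] at this
  -- After the substitution each y in B sees only the interval (a y, y), on which x⁻¹ ≤ (a y)⁻¹ and
  -- the slab bound at ε = y applies.
  have h2 : ∫⁻ l in Ioo 1 a⁻¹, ρ ((l * ·) ⁻¹' B) ≤ c * ENNReal.ofReal a⁻¹ * volume B := by
    rw [lintegral_measure_dilation one_pos (inv_pos.2 ha0) hB hBpos, ← setLIntegral_const]
    refine setLIntegral_mono' hB fun y hy => ?_
    have hy0 : 0 < y := (hB0 hy).1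
    rw [div_one, div_inv_eq_mul, mul_comm y a]
    calc ∫⁻ x in Ioo (a * y) y, ENNReal.ofReal x⁻¹ ∂ρ
        ≤ ∫⁻ _ in Ioo (a * y) y, ENNReal.ofReal (a * y)⁻¹ ∂ρ := by
          refine setLIntegral_mono' measurableSet_Ioo fun x hx => ENNReal.ofReal_le_ofReal ?_
          exact inv_anti₀ (by positivity) hx.1.le
      _ ≤ ENNReal.ofReal (a * y)⁻¹ * (c * ENNReal.ofReal y) := by
          rw [setLIntegral_const]
          gcongr
          exact h y (hB0 hy)
      _ = c * ENNReal.ofReal a⁻¹ := by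
          rw [mul_left_comm, ← ENNReal.ofReal_mul (by positivity)]
          congr 2
          field_simp
  have h3 := mul_le_mul_right (h1.trans h2) (ENNReal.ofReal a)
  rw [← mul_assoc, ← mul_assoc, ← ENNReal.ofReal_mul ha0.le, ← ENNReal.ofReal_mul
    (mul_nonneg ha0.le (sub_nonneg.2 (one_le_inv₀ ha0 |>.2 ha1.le)))] at h3
  have e1 : a * (a⁻¹ - 1) * a ^ d = (1 - a) * a ^ d := by field_simp
  have e2 : ENNReal.ofReal a * (c * ENNReal.ofReal a⁻¹ * volume B) = c * volume B := by
    calc _ = (ENNReal.ofReal a * ENNReal.ofReal a⁻¹) * (c * volume B) := by ring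
      _ = _ := by rw [← ENNReal.ofReal_mul ha0.le, mul_inv_cancel₀ ha0.ne']; simp
  rwa [e1, e2] at h3

/-- Mirror image of `measure_le_of_dilation`: averaging runs over l in (a, 1), and y in B sees the
interval (y, y / a). The slab bound is thus used at ε = y / a, which is why B must lie below a * ε₀.
-/
theorem le_measure_of_dilation {ρ : Measure ℝ} [SFinite ρ] {d : ℕ}
    (hρ : ∀ l : ℝ, 1 ≤ l → ∀ B : Set ℝ, MeasurableSet B → B ⊆ Ioi 0 →
      ρ B ≤ ENNReal.ofReal l ^ d * ρ ((l * ·) ⁻¹' B))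
    {a ε₀ : ℝ} (ha0 : 0 < a) {c : ℝ≥0∞}
    (h : ∀ ε ∈ Ioo 0 ε₀, c * ENNReal.ofReal ε ≤ ρ (Ioo (a * ε) ε))
    {B : Set ℝ} (hB : MeasurableSet B) (hB0 : B ⊆ Ioo 0 (a * ε₀)) :
    ENNReal.ofReal (a ^ d) * (c * volume B) ≤ ENNReal.ofReal (1 - a) * ρ B := by
  have hBpos : B ⊆ Ioi 0 := fun x hx => (hB0 hx).1
  have h1 : ENNReal.ofReal (a ^ d) * ∫⁻ l in Ioo a 1, ρ ((l * ·) ⁻¹' B) ≤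
      ENNReal.ofReal (1 - a) * ρ B := by
    rw [mul_comm (ENNReal.ofReal (1 - a)), ← Real.volume_Ioo, ← setLIntegral_const,
      ← lintegral_const_mul']
    swap
    · exact ENNReal.ofReal_ne_top
    refine setLIntegral_mono' measurableSet_Ioo fun l hl => ?_
    have hl0 : 0 < l := ha0.trans hl.1
    -- Since l < 1, the hypothesis is used with the factor l⁻¹ on the dilated set B / l; dilating
    -- again gives back B.
    have h4 := hρ l⁻¹ (one_le_inv₀ hl0 |>.2 hl.2.le) ((l * ·) ⁻¹' B)
      ((measurable_const_mul l) hB) (fun x hx => by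
        have := hBpos hx
        exact (pos_iff_pos_of_mul_pos this).1 hl0)
    have h5 : (l⁻¹ * ·) ⁻¹' ((l * ·) ⁻¹' B) = B := by
      ext x
      simp [mul_inv_cancel_left₀ hl0.ne']
    rw [h5] at h4
    refine (mul_le_mul_right h4 _).trans ?_
    rw [← mul_assoc, ← ENNReal.ofReal_pow (inv_pos.2 hl0).le, ← ENNReal.ofReal_mul (by positivity),
      ← mul_pow]
    refine mul_le_of_le_one_left zero_le ?_
    rw [ENNReal.ofReal_le_one]
    refine pow_le_one₀ (by positivity) ?_
    rw [← div_eq_mul_inv]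
    exact (div_le_one hl0).2 hl.1.le
  refine le_trans (mul_le_mul_right ?_ _) h1
  rw [lintegral_measure_dilation ha0 one_pos hB hBpos, ← setLIntegral_const]
  refine setLIntegral_mono' hB fun y hy => ?_
  have hy0 : 0 < y := (hB0 hy).1
  rw [div_one]
  calc c = ENNReal.ofReal (y / a)⁻¹ * (c * ENNReal.ofReal (y / a)) := by
          rw [mul_left_comm, ← ENNReal.ofReal_mul (by positivity), inv_mul_cancel₀ (by positivity)]
          simp
    _ ≤ ENNReal.ofReal (y / a)⁻¹ * ρ (Ioo y (y / a)) := by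
          gcongr
          have := h (y / a) ⟨by positivity, (div_lt_iff₀ ha0).2 (by
            rw [mul_comm]; exact (hB0 hy).2)⟩
          rwa [mul_div_cancel₀ _ ha0.ne'] at this
    _ ≤ ∫⁻ x in Ioo y (y / a), ENNReal.ofReal x⁻¹ ∂ρ := by
          rw [← setLIntegral_const]
          refine setLIntegral_mono' measurableSet_Ioo fun x hx => ENNReal.ofReal_le_ofReal ?_
          exact inv_anti₀ (hy0.trans hx.1) hx.2.le

end BoundaryRD

/-! ### Smooth patches as Lipschitz graphs, and the two sides of a graph -/

namespace BoundaryRD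

open scoped ENNReal NNReal

/-- Near `p`, in suitable orthonormal coordinates, `D` is the graph of a `δ`-Lipschitz function `ψ`
and `S` is the part above the graph. -/
def IsLocalGraph {n : ℕ} (D S : Set (Eucl (n + 1))) (δ : ℝ≥0) (p : Eucl (n + 1)) : Prop :=
  ∃ (L : Eucl (n + 1) ≃ₗᵢ[ℝ] WithLp 2 (Eucl n × ℝ)) (ψ : Eucl n → ℝ), LipschitzWith δ ψ ∧
    ∀ᶠ x in 𝓝 p, (x ∈ D ↔ (L x).snd = ψ (L x).fst) ∧ (x ∈ S ↔ ψ (L x).fst < (L x).snd)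

/-- The range of A is a hyperplane; orthonormal bases of it and of its one-dimensional complement
give coordinates in which it is horizontal. -/
theorem exists_isometry_snd_eq_zero {n : ℕ} (A : Eucl n →L[ℝ] Eucl (n + 1))
    (hA : Function.Injective A) :
    ∃ L : Eucl (n + 1) ≃ₗᵢ[ℝ] WithLp 2 (Eucl n × ℝ), ∀ v, (L (A v)).snd = 0 := by
  set K : Submodule ℝ (Eucl (n + 1)) := LinearMap.range A.toLinearMap with hK
  have h1 : Module.finrank ℝ K = n := by
    rw [hK, LinearMap.finrank_range_of_inj hA, finrank_euclideanSpace_fin]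
  have h2 : Module.finrank ℝ Kᗮ = 1 := by
    have := K.finrank_add_finrank_orthogonal
    rw [h1, finrank_euclideanSpace_fin] at this
    omega
  let e1 : K ≃ₗᵢ[ℝ] Eucl n := ((stdOrthonormalBasis ℝ K).reindex (finCongr h1)).repr
  let e2 : Kᗮ ≃ₗᵢ[ℝ] ℝ := ((stdOrthonormalBasis ℝ Kᗮ).reindex (finCongr h2)).equiv
    (OrthonormalBasis.singleton (Fin 1) ℝ) (Equiv.refl _)
  refine ⟨K.orthogonalDecomposition.trans (LinearIsometryEquiv.withLpProdCongr 2 e1 e2),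
    fun v => ?_⟩
  have h3 : Kᗮ.orthogonalProjectionOnto (A v) = 0 := by
    apply Submodule.orthogonalProjectionOnto_apply_of_mem_orthogonal
    exact Submodule.le_orthogonal_orthogonal _ (LinearMap.mem_range_self A.toLinearMap v)
  have h4 : (K.orthogonalDecomposition (A v)).snd = 0 := by
    rw [Submodule.snd_orthogonalDecomposition_apply, h3]
  have h5 : ((K.orthogonalDecomposition.trans (LinearIsometryEquiv.withLpProdCongr 2 e1 e2))
      (A v)).snd = e2 (K.orthogonalDecomposition (A v)).snd := rfl
  rw [h5, h4, map_zero]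

/-- A set which near `p` is the image of an immersion is near `p` the graph of a Lipschitz function
with small constant. -/
theorem exists_graph_of_immersion {n : ℕ} {D : Set (Eucl (n + 1))} {φ : Eucl n → Eucl (n + 1)}
    {u : Eucl n} (hφ : ContDiff ℝ ∞ φ) (hinj : Function.Injective (fderiv ℝ φ u))
    (h1 : ∀ N ∈ 𝓝 u, ∀ᶠ x in 𝓝 (φ u), x ∈ D → ∃ v ∈ N, x = φ v)
    (h2 : ∀ᶠ v in 𝓝 u, φ v ∈ D) {δ : ℝ≥0} (hδ : 0 < δ) :
    ∃ (L : Eucl (n + 1) ≃ₗᵢ[ℝ] WithLp 2 (Eucl n × ℝ)) (ψ : Eucl n → ℝ), LipschitzWith δ ψ ∧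
      ∀ᶠ x in 𝓝 (φ u), x ∈ D ↔ (L x).snd = ψ (L x).fst := by
  obtain ⟨L, hL⟩ := exists_isometry_snd_eq_zero _ hinj
  set A := fderiv ℝ φ u with hAdef
  let P : Eucl (n + 1) →L[ℝ] Eucl n :=
    WithLp.fstL 2 ℝ (Eucl n) ℝ ∘L (L.toContinuousLinearEquiv : Eucl (n + 1) →L[ℝ] _)
  let s : Eucl (n + 1) →L[ℝ] ℝ :=
    WithLp.sndL 2 ℝ (Eucl n) ℝ ∘L (L.toContinuousLinearEquiv : Eucl (n + 1) →L[ℝ] _)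
  have hP : ∀ x, P x = (L x).fst := fun x => rfl
  have hs : ∀ x, s x = (L x).snd := fun x => rfl
  have hsA : s ∘L A = 0 := by
    ext v
    exact hL v
  have hPA : Function.Injective (P ∘L A) := by
    rw [injective_iff_map_eq_zero]
    intro v hv
    have h3 : ‖L (A v)‖ ^ 2 = 0 := by
      have hv' : (L (A v)).fst = 0 := hv
      rw [WithLp.prod_norm_sq_eq_of_L2, hL v, hv']
      simp
    have h4 : ‖A v‖ = 0 := by
      rw [← L.norm_map]
      exact pow_eq_zero_iff two_ne_zero |>.1 h3
    exact (injective_iff_map_eq_zero A).1 hinj v (norm_eq_zero.1 h4)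
  let T : Eucl n ≃L[ℝ] Eucl n :=
    (LinearEquiv.ofInjectiveEndo (P ∘L A).toLinearMap hPA).toContinuousLinearEquiv
  have hT : (T : Eucl n →L[ℝ] Eucl n) = P ∘L A := by
    ext1 v
    rfl
  have hφ' : HasStrictFDerivAt φ A u := hφ.hasStrictFDerivAt (by simp)
  -- The horizontal part of φ has invertible derivative at u, so horizontal position serves as a
  -- local parameter.
  have hf : HasStrictFDerivAt (fun v => P (φ v)) (T : Eucl n →L[ℝ] Eucl n) u := by
    rw [hT]
    exact P.hasStrictFDerivAt.comp u hφ'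
  set θ := hf.localInverse with hθ
  have hθu : θ (P (φ u)) = u := hf.localInverse_apply_image
  have hθc : ContinuousAt θ (P (φ u)) := hf.localInverse_continuousAt
  -- In these tangent coordinates the height has derivative 0 at the base point, and strict
  -- differentiability makes it Lipschitz nearby with any positive constant.
  have hψ : HasStrictFDerivAt (fun w => s (φ (θ w))) (0 : Eucl n →L[ℝ] ℝ) (P (φ u)) := by
    have h3 : HasStrictFDerivAt (fun v => s (φ v)) (s ∘L A) (θ (P (φ u))) := by
      rw [hθu]
      exact s.hasStrictFDerivAt.comp u hφ'
    have h4 := h3.comp (P (φ u)) hf.to_localInverse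
    rwa [hsA, ContinuousLinearMap.zero_comp] at h4
  obtain ⟨W, hW, hlip⟩ := hψ.exists_lipschitzOnWith_of_nnnorm_lt δ (by simpa using hδ)
  obtain ⟨ψ, hψlip, heq⟩ := hlip.extend_real
  refine ⟨L, ψ, hψlip, ?_⟩
  have hPc : ContinuousAt P (φ u) := P.continuous.continuousAt
  have h5 := h1 _ (hf.eventually_left_inverse)
  have h6 : ∀ᶠ w in 𝓝 (P (φ u)), φ (θ w) ∈ D := hθc.eventually (by rwa [hθu])
  filter_upwards [h5, hPc.eventually hf.eventually_right_inverse, hPc.eventually h6,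
    hPc.eventually hW] with x h5x h7 h8 h9
  constructor
  · intro hx
    obtain ⟨v, hv, rfl⟩ := h5x hx
    rw [← hP, ← heq h9, ← hs]
    have hv' : θ (P (φ v)) = v := hv
    simp only [hv']
  · intro hx
    have h10 : φ (θ (P x)) = x := by
      apply L.injective
      apply (WithLp.equiv 2 _).injective
      refine Prod.ext ?_ ?_
      · exact h7
      · change s (φ (θ (P x))) = (L x).snd
        rw [hx, ← hP, ← heq h9]
    rw [← h10]
    exact h8

/-- Near p the complement of the graph consists of two connected pieces, above and below. An open
set with frontier in D that avoids D contains each piece that it meets. Both S₁ and S₂ accumulate at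
p and they are disjoint, so each takes exactly one piece. -/
theorem graph_sides {n : ℕ} {D S₁ S₂ : Set (Eucl (n + 1))} {p : Eucl (n + 1)}
    {L : Eucl (n + 1) ≃ₗᵢ[ℝ] WithLp 2 (Eucl n × ℝ)} {ψ : Eucl n → ℝ} (hψ : Continuous ψ)
    (hD : ∀ᶠ x in 𝓝 p, x ∈ D ↔ (L x).snd = ψ (L x).fst) (hp : p ∈ D)
    (hS₁ : IsOpen S₁) (hS₂ : IsOpen S₂) (hf₁ : frontier S₁ ⊆ D) (hf₂ : frontier S₂ ⊆ D)
    (hd₁ : Disjoint S₁ D) (hd₂ : Disjoint S₂ D) (hd : Disjoint S₁ S₂)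
    (hp₁ : p ∈ closure S₁) (hp₂ : p ∈ closure S₂) :
    (∀ᶠ x in 𝓝 p, (x ∈ S₁ ↔ ψ (L x).fst < (L x).snd) ∧ (x ∈ S₂ ↔ (L x).snd < ψ (L x).fst)) ∨
    (∀ᶠ x in 𝓝 p, (x ∈ S₂ ↔ ψ (L x).fst < (L x).snd) ∧ (x ∈ S₁ ↔ (L x).snd < ψ (L x).fst)) := by
  -- `Φ` and `c` are inverse shears that flatten the graph, so that the two pieces are images of
  -- products of a ball and an interval.
  let Φ : Eucl n × ℝ → Eucl (n + 1) := fun z => L.symm (WithLp.toLp 2 (z.1, ψ z.1 + z.2))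
  let c : Eucl (n + 1) → Eucl n × ℝ := fun x => ((L x).fst, (L x).snd - ψ (L x).fst)
  have hfst : Continuous fun x => (L x).fst :=
    (WithLp.fstL 2 ℝ (Eucl n) ℝ).continuous.comp L.continuous
  have hsnd : Continuous fun x => (L x).snd :=
    (WithLp.sndL 2 ℝ (Eucl n) ℝ).continuous.comp L.continuous
  have hΦ : Continuous Φ := L.symm.continuous.comp
    ((WithLp.prod_continuous_toLp 2 _ _).comp (by fun_prop))
  have hc : Continuous c := hfst.prodMk (hsnd.sub (hψ.comp hfst))
  have hΦc : ∀ x, Φ (c x) = x := fun x => by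
    apply L.injective
    simp only [Φ, c, LinearIsometryEquiv.apply_symm_apply, add_sub_cancel]
    rfl
  have hLΦ1 : ∀ z, (L (Φ z)).fst = z.1 := fun z => by
    simp only [Φ, LinearIsometryEquiv.apply_symm_apply]
    rfl
  have hLΦ2 : ∀ z, (L (Φ z)).snd = ψ z.1 + z.2 := fun z => by
    simp only [Φ, LinearIsometryEquiv.apply_symm_apply]
    rfl
  have hcp : c p = ((L p).fst, 0) := by
    simp only [c, hD.self_of_nhds.1 hp, sub_self]
  have hD' : ∀ᶠ z in 𝓝 (((L p).fst, 0) : Eucl n × ℝ), Φ z ∈ D ↔ z.2 = 0 := by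
    rw [← hcp]
    have : Tendsto Φ (𝓝 (c p)) (𝓝 p) := by
      have := hΦ.tendsto (c p)
      rwa [hΦc] at this
    filter_upwards [this.eventually hD] with z hz
    rw [hz, hLΦ1, hLΦ2]
    simp
  obtain ⟨ρ, hρ, hball⟩ := Metric.eventually_nhds_iff_ball.1 hD'
  rw [← ball_prod_same] at hball
  have hcball : ∀ᶠ x in 𝓝 p, c x ∈ Metric.ball (L p).fst ρ ×ˢ Metric.ball (0 : ℝ) ρ :=
    hc.continuousAt.eventually_mem (by
      rw [hcp, ball_prod_same]
      exact Metric.ball_mem_nhds _ hρ)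
  set Up := Φ '' (Metric.ball (L p).fst ρ ×ˢ Ioo 0 ρ) with hUp
  set Um := Φ '' (Metric.ball (L p).fst ρ ×ˢ Ioo (-ρ) 0) with hUm
  have hUpc : IsPreconnected Up := (((convex_ball _ _).isPreconnected).prod
    isPreconnected_Ioo).image _ hΦ.continuousOn
  have hUmc : IsPreconnected Um := (((convex_ball _ _).isPreconnected).prod
    isPreconnected_Ioo).image _ hΦ.continuousOn
  have hUpD : Disjoint Up D := by
    rw [disjoint_left]
    rintro _ ⟨z, hz, rfl⟩ hzD
    have := (hball z ⟨hz.1, by rw [Real.ball_eq_Ioo]; constructor <;> linarith [hz.2.1, hz.2.2]⟩).1 hzD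
    exact hz.2.1.ne' this
  have hUmD : Disjoint Um D := by
    rw [disjoint_left]
    rintro _ ⟨z, hz, rfl⟩ hzD
    have := (hball z ⟨hz.1, by rw [Real.ball_eq_Ioo]; constructor <;> linarith [hz.2.1, hz.2.2]⟩).1 hzD
    exact hz.2.2.ne this
  have hmem : ∀ x, c x ∈ Metric.ball (L p).fst ρ ×ˢ Metric.ball (0 : ℝ) ρ →
      (x ∈ D ↔ (L x).snd = ψ (L x).fst) ∧ (ψ (L x).fst < (L x).snd → x ∈ Up) ∧
      ((L x).snd < ψ (L x).fst → x ∈ Um) := by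
    intro x hx
    have h1 := hball _ hx
    rw [hΦc] at h1
    have h2 := hx.2
    rw [Real.ball_eq_Ioo] at h2
    refine ⟨h1.trans sub_eq_zero, fun h => ⟨c x, ⟨hx.1, sub_pos.2 h, by linarith [h2.2]⟩, hΦc x⟩,
      fun h => ⟨c x, ⟨hx.1, by linarith [h2.1], sub_neg.2 h⟩, hΦc x⟩⟩
  have hor : ∀ S : Set (Eucl (n + 1)), IsOpen S → frontier S ⊆ D → Disjoint S D → p ∈ closure S →
      Up ⊆ S ∨ Um ⊆ S := by
    intro S hS hfS hSD hpS
    obtain ⟨x, hx, hxS⟩ := mem_closure_iff_nhds.1 hpS _ hcball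
    obtain ⟨h1, h2, h3⟩ := hmem x hx
    rcases lt_trichotomy (ψ (L x).fst) (L x).snd with h | h | h
    · exact Or.inl (subset_of_disjoint_frontier hS hUpc hfS hUpD ⟨x, h2 h, hxS⟩)
    · exact absurd (h1.2 h.symm) (disjoint_left.1 hSD hxS)
    · exact Or.inr (subset_of_disjoint_frontier hS hUmc hfS hUmD ⟨x, h3 h, hxS⟩)
  have hne : ∀ {U : Set (Eucl (n + 1))}, U.Nonempty → ¬ (U ⊆ S₁ ∧ U ⊆ S₂) := by
    rintro U ⟨x, hx⟩ ⟨h1, h2⟩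
    exact disjoint_left.1 hd (h1 hx) (h2 hx)
  have hUpne : Up.Nonempty := ⟨_, mem_image_of_mem Φ (x := ((L p).fst, ρ / 2))
    ⟨Metric.mem_ball_self hρ, by constructor <;> simp only <;> linarith⟩⟩
  have hUmne : Um.Nonempty := ⟨_, mem_image_of_mem Φ (x := ((L p).fst, -(ρ / 2)))
    ⟨Metric.mem_ball_self hρ, by constructor <;> simp only <;> linarith⟩⟩
  have final : ∀ {S T : Set (Eucl (n + 1))}, Disjoint S D → Disjoint T D → Disjoint S T →
      Up ⊆ S → Um ⊆ T → ∀ᶠ x in 𝓝 p, (x ∈ S ↔ ψ (L x).fst < (L x).snd) ∧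
        (x ∈ T ↔ (L x).snd < ψ (L x).fst) := by
    intro S T hSD hTD hST hS hT
    filter_upwards [hcball] with x hx
    obtain ⟨h1, h2, h3⟩ := hmem x hx
    refine ⟨⟨fun hxS => ?_, fun h => hS (h2 h)⟩, ⟨fun hxT => ?_, fun h => hT (h3 h)⟩⟩
    · rcases lt_trichotomy (ψ (L x).fst) (L x).snd with h | h | h
      · exact h
      · exact absurd (h1.2 h.symm) (disjoint_left.1 hSD hxS)
      · exact absurd (hT (h3 h)) (disjoint_left.1 hST hxS)
    · rcases lt_trichotomy (ψ (L x).fst) (L x).snd with h | h | h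
      · exact absurd hxT (disjoint_left.1 hST (hS (h2 h)))
      · exact absurd (h1.2 h.symm) (disjoint_left.1 hTD hxT)
      · exact h
  rcases hor S₁ hS₁ hf₁ hd₁ hp₁ with h₁ | h₁ <;> rcases hor S₂ hS₂ hf₂ hd₂ hp₂ with h₂ | h₂
  · exact absurd ⟨h₁, h₂⟩ (hne hUpne)
  · exact Or.inl (final hd₁ hd₂ hd h₁ h₂)
  · exact Or.inr (final hd₂ hd₁ hd.symm h₂ h₁)
  · exact absurd ⟨h₁, h₂⟩ (hne hUmne)

/-- `IsLocalGraph` only knows the upper side; reflecting the vertical axis turns the lower side into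
it. -/
theorem isLocalGraph_of_below {n : ℕ} {D S : Set (Eucl (n + 1))} {p : Eucl (n + 1)}
    {L : Eucl (n + 1) ≃ₗᵢ[ℝ] WithLp 2 (Eucl n × ℝ)} {ψ : Eucl n → ℝ} {δ : ℝ≥0}
    (hψ : LipschitzWith δ ψ)
    (h : ∀ᶠ x in 𝓝 p, (x ∈ D ↔ (L x).snd = ψ (L x).fst) ∧ (x ∈ S ↔ (L x).snd < ψ (L x).fst)) :
    IsLocalGraph D S δ p := by
  refine ⟨L.trans (LinearIsometryEquiv.withLpProdCongr 2 (LinearIsometryEquiv.refl ℝ _)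
    (LinearIsometryEquiv.neg ℝ)), fun u => -ψ u, hψ.neg, ?_⟩
  filter_upwards [h] with x hx
  rw [hx.1, hx.2]
  change _ ∧ (_ ↔ -ψ (L x).fst < -(L x).snd)
  refine ⟨?_, neg_lt_neg_iff.symm⟩
  change _ ↔ -(L x).snd = -ψ (L x).fst
  exact neg_inj.symm

theorem isLocalGraph_of_immersion {n : ℕ} {D S₁ S₂ : Set (Eucl (n + 1))}
    {φ : Eucl n → Eucl (n + 1)} {u : Eucl n} (hφ : ContDiff ℝ ∞ φ)
    (hinj : Function.Injective (fderiv ℝ φ u))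
    (h1 : ∀ N ∈ 𝓝 u, ∀ᶠ x in 𝓝 (φ u), x ∈ D → ∃ v ∈ N, x = φ v)
    (h2 : ∀ᶠ v in 𝓝 u, φ v ∈ D) {δ : ℝ≥0} (hδ : 0 < δ)
    (hS₁ : IsOpen S₁) (hS₂ : IsOpen S₂) (hf₁ : frontier S₁ ⊆ D) (hf₂ : frontier S₂ ⊆ D)
    (hd₁ : Disjoint S₁ D) (hd₂ : Disjoint S₂ D) (hd : Disjoint S₁ S₂)
    (hp₁ : φ u ∈ closure S₁) (hp₂ : φ u ∈ closure S₂) :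
    IsLocalGraph D S₁ δ (φ u) ∧ IsLocalGraph D S₂ δ (φ u) := by
  obtain ⟨L, ψ, hψ, hD⟩ := exists_graph_of_immersion hφ hinj h1 h2 hδ
  rcases graph_sides hψ.continuous hD h2.self_of_nhds hS₁ hS₂ hf₁ hf₂ hd₁ hd₂ hd hp₁ hp₂ with h | h
  · exact ⟨⟨L, ψ, hψ, by filter_upwards [hD, h] with x hx hx'; exact ⟨hx, hx'.1⟩⟩,
      isLocalGraph_of_below hψ (by filter_upwards [hD, h] with x hx hx'; exact ⟨hx, hx'.2⟩)⟩
  · exact ⟨isLocalGraph_of_below hψ (by filter_upwards [hD, h] with x hx hx'; exact ⟨hx, hx'.2⟩),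
      ⟨L, ψ, hψ, by filter_upwards [hD, h] with x hx hx'; exact ⟨hx, hx'.1⟩⟩⟩

end BoundaryRD

/-! ### Volume of slabs along a Lipschitz graph -/

namespace BoundaryRD

open scoped ENNReal NNReal

section Graph

variable {n : ℕ} {L : Eucl (n + 1) ≃ₗᵢ[ℝ] WithLp 2 (Eucl n × ℝ)} {ψ : Eucl n → ℝ} {δ : ℝ≥0}

theorem lipschitzWith_fst (L : Eucl (n + 1) ≃ₗᵢ[ℝ] WithLp 2 (Eucl n × ℝ)) :
    LipschitzWith 1 fun x => (L x).fst := by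
  refine LipschitzWith.of_dist_le' (fun x y => ?_) |>.weaken (by simp : (1 : ℝ).toNNReal ≤ 1)
  rw [one_mul, dist_eq_norm, dist_eq_norm, ← L.norm_map (x - y), map_sub]
  refine le_of_sq_le_sq ?_ (norm_nonneg _)
  rw [WithLp.prod_norm_sq_eq_of_L2]
  exact le_add_of_nonneg_right (sq_nonneg _)

theorem lipschitzWith_snd (L : Eucl (n + 1) ≃ₗᵢ[ℝ] WithLp 2 (Eucl n × ℝ)) :
    LipschitzWith 1 fun x => (L x).snd := by
  refine LipschitzWith.of_dist_le' (fun x y => ?_) |>.weaken (by simp : (1 : ℝ).toNNReal ≤ 1)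
  rw [one_mul, dist_eq_norm, dist_eq_norm, ← L.norm_map (x - y), map_sub]
  refine le_of_sq_le_sq ?_ (norm_nonneg _)
  rw [WithLp.prod_norm_sq_eq_of_L2]
  exact le_add_of_nonneg_left (sq_nonneg _)

/-- The parametrization of the graph of `ψ` in the coordinates `L`. -/
noncomputable def graphMap (L : Eucl (n + 1) ≃ₗᵢ[ℝ] WithLp 2 (Eucl n × ℝ)) (ψ : Eucl n → ℝ)
    (u : Eucl n) : Eucl (n + 1) :=
  L.symm (WithLp.toLp 2 (u, ψ u))

theorem fst_graphMap (u : Eucl n) : (L (graphMap L ψ u)).fst = u := by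
  rw [graphMap, LinearIsometryEquiv.apply_symm_apply]; rfl

theorem snd_graphMap (u : Eucl n) : (L (graphMap L ψ u)).snd = ψ u := by
  rw [graphMap, LinearIsometryEquiv.apply_symm_apply]; rfl

theorem dist_graphMap_fst (x : Eucl (n + 1)) :
    dist x (graphMap L ψ (L x).fst) = |(L x).snd - ψ (L x).fst| := by
  rw [dist_eq_norm, ← L.norm_map, map_sub]
  have h : ‖L x - L (graphMap L ψ (L x).fst)‖ ^ 2 = |(L x).snd - ψ (L x).fst| ^ 2 := by
    have h1 : (L x - L (graphMap L ψ (L x).fst)).fst = 0 := by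
      rw [WithLp.sub_fst, fst_graphMap, sub_self]
    have h2 : (L x - L (graphMap L ψ (L x).fst)).snd = (L x).snd - ψ (L x).fst := by
      rw [WithLp.sub_snd, snd_graphMap]
    rw [WithLp.prod_norm_sq_eq_of_L2, h1, h2]
    simp
  exact (pow_left_inj₀ (norm_nonneg _) (abs_nonneg _) two_ne_zero).1 h

theorem graphMap_fst_of_mem {x : Eucl (n + 1)} (hx : (L x).snd = ψ (L x).fst) :
    graphMap L ψ (L x).fst = x := by
  have := dist_graphMap_fst (L := L) (ψ := ψ) x
  rw [hx, sub_self, abs_zero] at this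
  exact (dist_eq_zero.1 this).symm

theorem lipschitzWith_graphMap (hψ : LipschitzWith δ ψ) :
    LipschitzWith (1 + δ) (graphMap L ψ) := by
  refine LipschitzWith.of_dist_le_mul (fun u v => ?_)
  rw [dist_eq_norm, ← L.norm_map, map_sub]
  have h1 : (L (graphMap L ψ u) - L (graphMap L ψ v)).fst = u - v := by
    rw [WithLp.sub_fst, fst_graphMap, fst_graphMap]
  have h2 : (L (graphMap L ψ u) - L (graphMap L ψ v)).snd = ψ u - ψ v := by
    rw [WithLp.sub_snd, snd_graphMap, snd_graphMap]
  refine le_of_sq_le_sq ?_ (by positivity)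
  rw [WithLp.prod_norm_sq_eq_of_L2, h1, h2, ← dist_eq_norm, ← dist_eq_norm]
  have h3 := hψ.dist_le_mul u v
  have h4 : dist (ψ u) (ψ v) ^ 2 ≤ (δ * dist u v) ^ 2 := by gcongr
  have h5 : 0 ≤ (δ : ℝ) * dist u v ^ 2 := by positivity
  push_cast
  nlinarith

/-- Vertical height exceeds the true distance to the graph at most by the factor 1 + δ. This makes
slabs in height and slabs in distance comparable. -/
theorem height_le (hψ : LipschitzWith δ ψ) (x : Eucl (n + 1)) {q : Eucl (n + 1)}
    (hq : (L q).snd = ψ (L q).fst) :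
    (L x).snd - ψ (L x).fst ≤ (1 + δ) * dist x q := by
  have h1 := (lipschitzWith_snd L).dist_le_mul x q
  have h2 := (lipschitzWith_fst L).dist_le_mul x q
  have h3 := hψ.dist_le_mul (L x).fst (L q).fst
  rw [Real.dist_eq] at h1 h3
  simp only [NNReal.coe_one, one_mul] at h1 h2
  have h4 : (δ : ℝ) * dist (L x).fst (L q).fst ≤ δ * dist x q := by gcongr
  have h5 := le_abs_self ((L x).snd - (L q).snd)
  have h6 := neg_abs_le (ψ (L x).fst - ψ (L q).fst)
  rw [← hq] at h3 h6
  linarith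

theorem volume_graph_slab (hψ : Continuous ψ) {A : Set (Eucl n)} (hA : MeasurableSet A)
    (α β : ℝ) :
    volume {x | (L x).fst ∈ A ∧ (L x).snd - ψ (L x).fst ∈ Ioo α β} =
      ENNReal.ofReal (β - α) * volume A := by
  have hmp : MeasurePreserving (fun x => WithLp.ofLp (L x)) volume
      (volume : Measure (Eucl n × ℝ)) :=
    (WithLp.volume_preserving_ofLp (Eucl n) ℝ).comp L.measurePreserving
  have hm : MeasurableSet {z : Eucl n × ℝ | z.1 ∈ A ∧ z.2 - ψ z.1 ∈ Ioo α β} :=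
    (measurable_fst hA).inter ((by fun_prop : Measurable fun z : Eucl n × ℝ => z.2 - ψ z.1)
      measurableSet_Ioo)
  have e := hmp.measure_preimage hm.nullMeasurableSet
  have e2 : (fun x => WithLp.ofLp (L x)) ⁻¹' {z : Eucl n × ℝ | z.1 ∈ A ∧ z.2 - ψ z.1 ∈ Ioo α β} =
    {x | (L x).fst ∈ A ∧ (L x).snd - ψ (L x).fst ∈ Ioo α β} := rfl
  rw [← e2, e, Measure.volume_eq_prod, Measure.prod_apply hm, ← setLIntegral_const,
    ← lintegral_indicator hA]
  refine lintegral_congr fun u => ?_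
  by_cases hu : u ∈ A
  · rw [indicator_of_mem hu]
    have : Prod.mk u ⁻¹' {z : Eucl n × ℝ | z.1 ∈ A ∧ z.2 - ψ z.1 ∈ Ioo α β} =
        Ioo (ψ u + α) (ψ u + β) := by
      ext y
      simp only [mem_preimage, mem_ofPred_eq, hu, true_and, mem_Ioo, lt_sub_iff_add_lt',
        sub_lt_iff_lt_add']
    rw [this, Real.volume_Ioo]
    congr 1; ring
  · rw [indicator_of_notMem hu]
    refine measure_mono_null (t := ∅) (fun y hy => hu hy.1) measure_empty

end Graph

/-- The points of `S` at distance between `a * ε` and `ε` from `D`. -/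
def slab {d : ℕ} (D S : Set (Eucl d)) (a ε : ℝ) : Set (Eucl d) :=
  S ∩ {x | Metric.infDist x D ∈ Ioo (a * ε) ε}

theorem exists_nearest {d : ℕ} {D : Set (Eucl d)} (hD : IsClosed D) (hne : D.Nonempty)
    (x : Eucl d) : ∃ q ∈ D, dist x q = Metric.infDist x D := by
  obtain ⟨q, hq, h⟩ := hD.exists_infDist_eq_dist hne x
  exact ⟨q, hq, h.symm⟩

/-- Slab points near C have height between a ε and (1 + δ) ε above the graph. Their feet lie in D
close to C, and projecting the feet to the horizontal plane does not increase Hausdorff measure.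
Continuity of the finite measure on D along shrinking thickenings replaces the feet by C in the
limit. -/
theorem eventually_volume_slab_le {n : ℕ} {D S U C : Set (Eucl (n + 1))} {δ : ℝ≥0}
    {L : Eucl (n + 1) ≃ₗᵢ[ℝ] WithLp 2 (Eucl n × ℝ)} {ψ : Eucl n → ℝ} (hψ : LipschitzWith δ ψ)
    (hU : IsOpen U)
    (hgraph : ∀ x ∈ U, (x ∈ D ↔ (L x).snd = ψ (L x).fst) ∧ (x ∈ S ↔ ψ (L x).fst < (L x).snd))
    (hD : IsClosed D) (hfin : μHE[n] D ≠ ⊤) (hC : IsCompact C) (hCD : C ⊆ D) (hCU : C ⊆ U) {a : ℝ}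
    {c : ℝ≥0∞} (hc : ENNReal.ofReal (1 + δ - a) * μHE[n] C < c) :
    ∀ᶠ ε in 𝓝[>] (0 : ℝ), volume (Metric.cthickening ε C ∩ slab D S a ε) ≤
      c * ENNReal.ofReal ε := by
  obtain ⟨r, hr, hrU⟩ := hC.exists_cthickening_subset_open hU hCU
  have h1 : Tendsto (fun ε => μHE[n].restrict D (Metric.cthickening ε C)) (𝓝 0)
      (𝓝 (μHE[n].restrict D C)) :=
    tendsto_measure_cthickening_of_isClosed ⟨1, one_pos,
      ((measure_mono (subset_univ _)).trans_lt (by simpa using hfin.lt_top)).ne⟩ hC.isClosed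
  have h2 : Tendsto (fun ε : ℝ => (2 + δ) * ε) (𝓝[>] 0) (𝓝 0) := by
    refine Tendsto.mono_left ?_ nhdsWithin_le_nhds
    exact (Continuous.tendsto' (by fun_prop) _ _ (by simp))
  have h3 : Tendsto (fun ε => ENNReal.ofReal (1 + δ - a) *
      μHE[n].restrict D (Metric.cthickening ((2 + δ) * ε) C)) (𝓝[>] 0)
      (𝓝 (ENNReal.ofReal (1 + δ - a) * μHE[n].restrict D C)) :=
    ENNReal.Tendsto.const_mul (h1.comp h2) (Or.inr ENNReal.ofReal_ne_top)
  rw [Measure.restrict_eq_self _ hCD] at h3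
  filter_upwards [h3.eventually (gt_mem_nhds hc), self_mem_nhdsWithin,
    h2.eventually (gt_mem_nhds hr)] with ε hε hε0 hεr
  have hε0 : 0 < ε := hε0
  have hδ : (0 : ℝ) ≤ δ := δ.2
  -- Radius: x is within ε of C, and its foot on the graph is within (1 + δ) ε of x.
  set A := (fun x => (L x).fst) '' (D ∩ Metric.cthickening ((2 + δ) * ε) C) with hA
  have hAc : IsCompact A := ((hC.cthickening).inter_left hD).image (lipschitzWith_fst L).continuous
  have hAle : volume A ≤ μHE[n].restrict D (Metric.cthickening ((2 + δ) * ε) C) := by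
    have := euclideanHausdorffMeasure_image_le ((lipschitzWith_fst L).lipschitzOnWith
      (s := D ∩ Metric.cthickening ((2 + δ) * ε) C)) n
    rw [EuclideanSpace.euclideanHausdorffMeasure_eq_volume] at this
    rw [Measure.restrict_apply Metric.isClosed_cthickening.measurableSet, inter_comm]
    simpa using this
  have hsub : Metric.cthickening ε C ∩ slab D S a ε ⊆
      {x | (L x).fst ∈ A ∧ (L x).snd - ψ (L x).fst ∈ Ioo (a * ε) ((1 + δ) * ε)} := by
    rintro x ⟨hxC, hxS, hx1, hx2⟩
    obtain ⟨y, hy, hxy⟩ := exists_dist_le_of_mem_cthickening hC hε0.le hxC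
    have hxU : x ∈ U := hrU (Metric.mem_cthickening_of_dist_le _ _ _ _ hy (by nlinarith))
    obtain ⟨q, hq, hxq⟩ := exists_nearest hD ⟨y, hCD hy⟩ x
    have hqU : q ∈ U := hrU (Metric.mem_cthickening_of_dist_le _ _ _ _ hy (by
      have := dist_triangle_left q y x
      nlinarith))
    have hv0 := ((hgraph x hxU).2.1 hxS)
    have hv := height_le (L := L) hψ x ((hgraph q hqU).1.1 hq)
    have hv1 : (L x).snd - ψ (L x).fst < (1 + δ) * ε := by
      refine hv.trans_lt ?_
      have : (0 : ℝ) < 1 + δ := by positivity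
      rw [hxq]
      exact mul_lt_mul_of_pos_left hx2 this
    set z := graphMap L ψ (L x).fst with hz
    have hxz : dist x z = (L x).snd - ψ (L x).fst := by
      rw [dist_graphMap_fst, abs_of_pos (sub_pos.2 hv0)]
    have hzy : dist z y ≤ (2 + δ) * ε := by
      have := dist_triangle_left z y x
      linarith
    have hzC : z ∈ Metric.cthickening ((2 + δ) * ε) C :=
      Metric.mem_cthickening_of_dist_le _ _ _ _ hy hzy
    have hzU : z ∈ U := hrU (Metric.cthickening_mono hεr.le _ hzC)
    have hzD : z ∈ D := (hgraph z hzU).1.2 (by rw [hz, fst_graphMap, snd_graphMap])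
    refine ⟨⟨z, ⟨hzD, hzC⟩, fst_graphMap _⟩, ?_, hv1⟩
    rw [← hxz]
    exact hx1.trans_le (Metric.infDist_le_dist_of_mem hzD)
  refine (measure_mono hsub).trans ?_
  rw [volume_graph_slab hψ.continuous hAc.isClosed.measurableSet, ← sub_mul,
    ENNReal.ofReal_mul' hε0.le, mul_right_comm]
  gcongr
  exact (mul_le_mul_right hAle _).trans hε.le

/-- Conversely, points over Q at height between (1 + δ) a ε and ε lie in the slab, and the graph
map, being (1 + δ)-Lipschitz, bounds the measure of Q by the volume of its projection. -/
theorem eventually_le_volume_slab {n : ℕ} {D S U Q : Set (Eucl (n + 1))} {δ : ℝ≥0}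
    {L : Eucl (n + 1) ≃ₗᵢ[ℝ] WithLp 2 (Eucl n × ℝ)} {ψ : Eucl n → ℝ} (hψ : LipschitzWith δ ψ)
    (hU : IsOpen U)
    (hgraph : ∀ x ∈ U, (x ∈ D ↔ (L x).snd = ψ (L x).fst) ∧ (x ∈ S ↔ ψ (L x).fst < (L x).snd))
    (hD : IsClosed D) (hQ : IsCompact Q) (hQD : Q ⊆ D) (hQU : Q ⊆ U) {a : ℝ} (ha : 0 ≤ a) :
    ∀ᶠ ε in 𝓝[>] (0 : ℝ), ENNReal.ofReal (1 - (1 + δ) * a) * μHE[n] Q * ENNReal.ofReal ε ≤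
      ENNReal.ofReal (1 + δ) ^ n * volume (Metric.thickening ε Q ∩ slab D S a ε) := by
  obtain ⟨r, hr, hrU⟩ := hQ.exists_cthickening_subset_open hU hQU
  have h2 : Tendsto (fun ε : ℝ => 2 * ε) (𝓝[>] 0) (𝓝 0) := by
    refine Tendsto.mono_left ?_ nhdsWithin_le_nhds
    exact (Continuous.tendsto' (by fun_prop) _ _ (by simp))
  filter_upwards [self_mem_nhdsWithin, h2.eventually (gt_mem_nhds hr)] with ε hε0 hεr
  have hε0 : 0 < ε := hε0
  have hδ : (0 : ℝ) ≤ δ := δ.2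
  set A := (fun x => (L x).fst) '' Q with hA
  have hAc : IsCompact A := hQ.image (lipschitzWith_fst L).continuous
  have hgr : ∀ x ∈ Q, graphMap L ψ (L x).fst = x := fun x hx =>
    graphMap_fst_of_mem ((hgraph x (hQU hx)).1.1 (hQD hx))
  have hQA : Q = graphMap L ψ '' A := by
    rw [hA, image_image]
    exact ((image_congr hgr).trans (image_id' Q)).symm
  have hle : μHE[n] Q ≤ ENNReal.ofReal (1 + δ) ^ n * volume A := by
    have := euclideanHausdorffMeasure_image_le ((lipschitzWith_graphMap (L := L) hψ).lipschitzOnWith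
      (s := A)) n
    rw [EuclideanSpace.euclideanHausdorffMeasure_eq_volume, ← hQA] at this
    convert this
    rw [ENNReal.ofReal, Real.toNNReal_of_nonneg (by positivity)]
    rfl
  have hsub : {x | (L x).fst ∈ A ∧ (L x).snd - ψ (L x).fst ∈ Ioo ((1 + δ) * a * ε) ε} ⊆
      Metric.thickening ε Q ∩ slab D S a ε := by
    rintro x ⟨⟨z, hz, hzx⟩, hv1, hv2⟩
    have hzx : (L z).fst = (L x).fst := hzx
    have hv0 : 0 < (L x).snd - ψ (L x).fst := lt_of_le_of_lt (by positivity) hv1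
    have hxz : dist x z = (L x).snd - ψ (L x).fst := by
      rw [← abs_of_pos hv0, ← dist_graphMap_fst, ← hzx, hgr z hz]
    have hxU : x ∈ U := hrU (Metric.mem_cthickening_of_dist_le _ _ _ _ hz (by linarith))
    have hle := Metric.infDist_le_dist_of_mem (x := x) (hQD hz)
    obtain ⟨q, hq, hxq⟩ := exists_nearest hD ⟨z, hQD hz⟩ x
    have hqU : q ∈ U := hrU (Metric.mem_cthickening_of_dist_le _ _ _ _ hz (by
      have := dist_triangle_left q z x
      linarith))
    have hv := height_le (L := L) hψ x ((hgraph q hqU).1.1 hq)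
    refine ⟨Metric.mem_thickening_iff.2 ⟨z, hz, by linarith⟩,
      (hgraph x hxU).2.2 (sub_pos.1 hv0), ?_, by linarith⟩
    rw [hxq] at hv
    have h3 : (1 + (δ : ℝ)) * (a * ε) < (1 + δ) * Metric.infDist x D := by linarith
    exact lt_of_mul_lt_mul_left h3 (by positivity)
  refine le_trans ?_ (mul_le_mul_right (measure_mono hsub) _)
  rw [volume_graph_slab hψ.continuous hAc.isClosed.measurableSet]
  have e : ε - (1 + δ) * a * ε = (1 - (1 + δ) * a) * ε := by ring
  rw [e, ENNReal.ofReal_mul' hε0.le]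
  calc _ ≤ ENNReal.ofReal (1 - (1 + δ) * a) * (ENNReal.ofReal (1 + δ) ^ n * volume A) *
        ENNReal.ofReal ε := by gcongr
    _ = _ := by ring

end BoundaryRD

/-! ### From graph pieces to the whole boundary -/

namespace BoundaryRD

open scoped ENNReal NNReal

/-- The finite measure `κ` controls the Hausdorff measure and the upper Minkowski content of the
subsets of `D`. -/
structure ControlsContent {n : ℕ} (D : Set (Eucl (n + 1))) (κ : Measure (Eucl (n + 1)))
    (M : ℝ≥0∞) : Prop where
  ne_top : M ≠ ⊤
  hausdorff_le : ∀ R ⊆ D, MeasurableSet R → μHE[n] R ≤ M * κ R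
  eventually_volume_le : ∀ R ⊆ D, IsCompact R → ∀ c, M * κ R < c →
    ∀ᶠ ε in 𝓝[>] (0 : ℝ), volume (Metric.cthickening ε R) ≤ c * ENNReal.ofReal ε

theorem ControlsContent.hausdorff_ne_top {n : ℕ} {D : Set (Eucl (n + 1))}
    {κ : Measure (Eucl (n + 1))} [IsFiniteMeasure κ] {M : ℝ≥0∞} (h : ControlsContent D κ M)
    (hD : IsCompact D) : μHE[n] D ≠ ⊤ :=
  ((h.hausdorff_le D subset_rfl hD.isClosed.measurableSet).trans_lt
    (ENNReal.mul_lt_top h.ne_top.lt_top (measure_lt_top _ _))).ne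

/-- `κ`-almost all of `D` consists of points near which `D` is a Lipschitz graph bounding `S`,
with arbitrarily small Lipschitz constant. -/
def IsLocalGraphAE {n : ℕ} (D S : Set (Eucl (n + 1))) (κ : Measure (Eucl (n + 1))) : Prop :=
  ∀ η : ℝ≥0∞, 0 < η → ∃ K ⊆ D, IsCompact K ∧ κ (D \ K) < η ∧
    ∀ p ∈ K, ∀ δ : ℝ≥0, 0 < δ → IsLocalGraph D S δ p

/-- On `U` the set `D` is the graph of a `δ`-Lipschitz function, and `S` is the part above it. -/
def IsGraphOn {n : ℕ} (D S : Set (Eucl (n + 1))) (δ : ℝ≥0) (U : Set (Eucl (n + 1))) : Prop :=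
  ∃ (L : Eucl (n + 1) ≃ₗᵢ[ℝ] WithLp 2 (Eucl n × ℝ)) (ψ : Eucl n → ℝ), LipschitzWith δ ψ ∧
    ∀ x ∈ U, (x ∈ D ↔ (L x).snd = ψ (L x).fst) ∧ (x ∈ S ↔ ψ (L x).fst < (L x).snd)

/-- Finitely many graph neighbourhoods cover the regular compact set. Making them disjoint and
shrinking by inner regularity of κ gives separated compact pieces at arbitrarily small cost. -/
theorem IsLocalGraphAE.exists_decomposition {n : ℕ} {D S : Set (Eucl (n + 1))}
    {κ : Measure (Eucl (n + 1))} [IsFiniteMeasure κ] (h : IsLocalGraphAE D S κ)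
    {δ : ℝ≥0} (hδ : 0 < δ) {η : ℝ≥0∞} (hη : 0 < η) :
    ∃ (N : ℕ) (Q U : Fin N → Set (Eucl (n + 1))), (∀ i, IsCompact (Q i)) ∧ (∀ i, Q i ⊆ D) ∧
      (∀ i, Q i ⊆ U i) ∧ (∀ i, IsOpen (U i)) ∧ (∀ i, IsGraphOn D S δ (U i)) ∧
      Pairwise (Function.onFun Disjoint Q) ∧ κ (D \ ⋃ i, Q i) < η := by
  obtain ⟨K, hKD, hK, hKη, hgraph⟩ := h (η / 2) (ENNReal.half_pos hη.ne')
  have hloc : ∀ p ∈ K, ∃ U : Set (Eucl (n + 1)), p ∈ U ∧ IsOpen U ∧ IsGraphOn D S δ U := by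
    intro p hp
    obtain ⟨L, ψ, hψ, hev⟩ := hgraph p hp δ hδ
    obtain ⟨U, hU, hUo, hpU⟩ := eventually_nhds_iff.1 hev
    exact ⟨U, hpU, hUo, L, ψ, hψ, hU⟩
  choose! V hpV hVo hVg using hloc
  obtain ⟨t, htK, htc⟩ := hK.elim_nhds_subcover V fun p hp => (hVo p hp).mem_nhds (hpV p hp)
  let e := t.equivFin.symm
  let U : Fin t.card → Set (Eucl (n + 1)) := fun i => V (e i)
  have hUK : K ⊆ ⋃ i, U i := by
    intro x hx
    obtain ⟨p, hp, hxp⟩ := mem_iUnion₂.1 (htc hx)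
    refine mem_iUnion.2 ⟨e.symm ⟨p, hp⟩, ?_⟩
    simpa [U] using hxp
  let B : Fin t.card → Set (Eucl (n + 1)) := fun i => K ∩ disjointed U i
  have hBm : ∀ i, MeasurableSet (B i) := fun i => hK.isClosed.measurableSet.inter
    (disjointedRec (p := MeasurableSet)
      (fun {_ j} h => h.diff (hVo _ (htK _ (e j).2)).measurableSet)
      (hVo _ (htK _ (e i).2)).measurableSet)
  obtain ⟨η', hη', hsum⟩ := ENNReal.exists_pos_sum_of_countable' (ENNReal.half_pos hη.ne').ne'
    (Fin t.card)
  choose Q hQB hQ hQη using fun i => (hBm i).exists_isCompact_sdiff_lt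
    (measure_ne_top κ (B i)) (hη' i).ne'
  refine ⟨t.card, Q, U, hQ, fun i => (hQB i).trans (inter_subset_left.trans hKD),
    fun i => (hQB i).trans (inter_subset_right.trans (disjointed_subset _ _)),
    fun i => hVo _ (htK _ (e i).2), fun i => hVg _ (htK _ (e i).2), ?_, ?_⟩
  · intro i j hij
    exact ((disjoint_disjointed U hij).mono inter_subset_right inter_subset_right).mono
      (hQB i) (hQB j)
  · have hsub : D \ ⋃ i, Q i ⊆ (D \ K) ∪ ⋃ i, B i \ Q i := by
      rintro x ⟨hxD, hxQ⟩
      by_cases hxK : x ∈ K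
      · have := hUK hxK
        rw [← iUnion_disjointed] at this
        obtain ⟨i, hi⟩ := mem_iUnion.1 this
        exact Or.inr (mem_iUnion.2 ⟨i, ⟨hxK, hi⟩, fun h => hxQ (mem_iUnion.2 ⟨i, h⟩)⟩)
      · exact Or.inl ⟨hxD, hxK⟩
    calc κ (D \ ⋃ i, Q i) ≤ κ (D \ K) + ∑' i, κ (B i \ Q i) :=
          (measure_mono hsub).trans ((measure_union_le _ _).trans
            (add_le_add_right (measure_iUnion_le _) _))
      _ < η / 2 + η / 2 := by
          refine ENNReal.add_lt_add hKη (lt_of_le_of_lt ?_ hsum)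
          exact ENNReal.tsum_le_tsum fun i => (hQη i).le
      _ = η := ENNReal.add_halves η

theorem measurableSet_slab {d : ℕ} {D S : Set (Eucl d)} (hS : IsOpen S) (a ε : ℝ) :
    MeasurableSet (slab D S a ε) :=
  hS.measurableSet.inter ((Metric.continuous_infDist_pt D).measurable measurableSet_Ioo)

/-- A slab point with nearest point q in C is near one of the graph pieces, where the graph estimate
applies, or q lies in the remainder, whose neighbourhoods are small because κ controls upper
Minkowski content. -/
theorem eventually_volume_nearSet_slab_le {n : ℕ} {D S C : Set (Eucl (n + 1))}
    {κ : Measure (Eucl (n + 1))} [IsFiniteMeasure κ] {M : ℝ≥0∞} (hκ : ControlsContent D κ M)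
    (hD : IsCompact D) (hgraph : IsLocalGraphAE D S κ) (hC : IsClosed C) (hCD : C ⊆ D) {a : ℝ}
    {c : ℝ≥0∞} (hc : ENNReal.ofReal (1 - a) * μHE[n] C < c) :
    ∀ᶠ ε in 𝓝[>] (0 : ℝ), volume (nearSet D C ∩ slab D S a ε) ≤ c * ENNReal.ofReal ε := by
  have hDfin := hκ.hausdorff_ne_top hD
  have hCfin : μHE[n] C ≠ ⊤ := ((measure_mono hCD).trans_lt hDfin.lt_top).ne
  -- All errors in one parameter t: Lipschitz constant t, measure t from enlarging the pieces, t for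
  -- the sum of the `τ i`, and M t + t for the remainder.
  have hlim : Tendsto (fun t : ℝ => ENNReal.ofReal (1 + t - a) * (μHE[n] C + ENNReal.ofReal t) +
      (ENNReal.ofReal t + (M * ENNReal.ofReal t + ENNReal.ofReal t))) (𝓝[>] 0)
      (𝓝 (ENNReal.ofReal (1 - a) * μHE[n] C)) := by
    refine Tendsto.mono_left ?_ nhdsWithin_le_nhds
    have ht : Tendsto (fun t : ℝ => ENNReal.ofReal t) (𝓝 0) (𝓝 0) :=
      ENNReal.continuous_ofReal.tendsto' _ _ (by simp)
    have h1 : Tendsto (fun t : ℝ => ENNReal.ofReal (1 + t - a)) (𝓝 0)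
        (𝓝 (ENNReal.ofReal (1 - a))) :=
      (ENNReal.continuous_ofReal.comp (by fun_prop : Continuous fun t : ℝ => 1 + t - a)).tendsto' _ _
        (by simp)
    have h2 : Tendsto (fun t : ℝ => μHE[n] C + ENNReal.ofReal t) (𝓝 0) (𝓝 (μHE[n] C + 0)) :=
      ht.const_add _
    have h3 := ENNReal.Tendsto.mul h1 (Or.inr (by simpa using hCfin)) h2
      (Or.inr ENNReal.ofReal_ne_top)
    have h4 := ENNReal.Tendsto.const_mul (a := M) ht (Or.inr hκ.ne_top)
    have h5 := h3.add (ht.add (h4.add ht))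
    simpa using h5
  obtain ⟨t, ht, ht0⟩ := ((hlim.eventually (gt_mem_nhds hc)).and self_mem_nhdsWithin).exists
  have ht0 : 0 < t := ht0
  have hT : 0 < ENNReal.ofReal t := ENNReal.ofReal_pos.2 ht0
  obtain ⟨N, Q, U, hQ, hQD, hQU, hUo, hUg, hdisj, hκQ⟩ :=
    hgraph.exists_decomposition (δ := t.toNNReal) (Real.toNNReal_pos.2 ht0) hT
  have hsum : ∑ i, μHE[n] (C ∩ Q i) ≤ μHE[n] C := by
    have := measure_iUnion (μ := μHE[n]) (f := fun i => C ∩ Q i)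
      (fun i j hij => (hdisj hij).mono inter_subset_right inter_subset_right)
      (fun i => (hC.inter (hQ i).isClosed).measurableSet)
    rw [tsum_fintype] at this
    rw [← this]
    exact measure_mono (iUnion_subset fun i => inter_subset_left)
  have hsumlim : Tendsto (fun ε => ∑ i, μHE[n] (C ∩ Metric.cthickening ε (Q i))) (𝓝[>] 0)
      (𝓝 (∑ i, μHE[n] (C ∩ Q i))) := by
    refine tendsto_finsetSum _ fun i _ => ?_
    have := tendsto_measure_cthickening_of_isClosed (μ := μHE[n].restrict C) (s := Q i)
      ⟨1, one_pos, ((measure_mono (subset_univ _)).trans_lt (by simpa using hCfin.lt_top)).ne⟩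
      (hQ i).isClosed
    simp only [Measure.restrict_apply Metric.isClosed_cthickening.measurableSet,
      Measure.restrict_apply (hQ i).isClosed.measurableSet, inter_comm _ C] at this
    exact this.mono_left nhdsWithin_le_nhds
  have hlt : ∑ i, μHE[n] (C ∩ Q i) < μHE[n] C + ENNReal.ofReal t :=
    hsum.trans_lt (ENNReal.lt_add_right hCfin hT.ne')
  have hsubU : ∀ᶠ ε in 𝓝[>] (0 : ℝ), ∀ i, Metric.cthickening ε (Q i) ⊆ U i := by
    refine eventually_all.2 fun i => ?_
    obtain ⟨r, hr, hrU⟩ := (hQ i).exists_cthickening_subset_open (hUo i) (hQU i)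
    filter_upwards [Ioo_mem_nhdsGT hr] with ε hε
    exact (Metric.cthickening_mono hε.2.le _).trans hrU
  obtain ⟨ε₀, ⟨hε₀sum, hε₀U⟩, hε₀⟩ :=
    (((hsumlim.eventually (gt_mem_nhds hlt)).and hsubU).and self_mem_nhdsWithin).exists
  have hε₀ : 0 < ε₀ := hε₀
  -- The content bound needs a compact remainder. Hence open thickenings of the pieces are removed
  -- from D, with `ε₀` so small that the enlarged pieces barely gain measure and stay in their graph
  -- neighbourhoods.
  set Cs : Fin N → Set (Eucl (n + 1)) := fun i => C ∩ Metric.cthickening ε₀ (Q i) with hCs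
  set R : Set (Eucl (n + 1)) := D \ ⋃ i, Metric.thickening ε₀ (Q i) with hR
  have hRc : IsCompact R := hD.diff (isOpen_iUnion fun i => Metric.isOpen_thickening)
  have hκR : κ R < ENNReal.ofReal t := lt_of_le_of_lt (measure_mono (sdiff_subset_sdiff_right
    (iUnion_mono fun i => Metric.self_subset_thickening hε₀ _))) hκQ
  obtain ⟨τ, hτ, hτsum⟩ := ENNReal.exists_pos_sum_of_countable' hT.ne' (Fin N)
  rw [tsum_fintype] at hτsum
  have hpiece : ∀ᶠ ε in 𝓝[>] (0 : ℝ), ∀ i, volume (Metric.cthickening ε (Cs i) ∩ slab D S a ε) ≤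
      (ENNReal.ofReal (1 + t - a) * μHE[n] (Cs i) + τ i) * ENNReal.ofReal ε := by
    refine eventually_all.2 fun i => ?_
    obtain ⟨L, ψ, hψ, hg⟩ := hUg i
    refine eventually_volume_slab_le hψ (hUo i) hg hD.isClosed hDfin
      ((hQ i).cthickening.inter_left hC) (inter_subset_left.trans hCD)
      (inter_subset_right.trans (hε₀U i)) ?_
    rw [Real.coe_toNNReal _ ht0.le]
    refine ENNReal.lt_add_right (ENNReal.mul_ne_top ENNReal.ofReal_ne_top ?_) (hτ i).ne'
    exact ((measure_mono inter_subset_left).trans_lt hCfin.lt_top).ne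
  have hrest := hκ.eventually_volume_le R sdiff_subset hRc
    (M * ENNReal.ofReal t + ENNReal.ofReal t)
    (lt_of_le_of_lt (mul_le_mul_right hκR.le _)
      (ENNReal.lt_add_right (ENNReal.mul_ne_top hκ.ne_top ENNReal.ofReal_ne_top) hT.ne'))
  filter_upwards [hpiece, hrest, self_mem_nhdsWithin] with ε h1 h2 hε
  have hε : 0 < ε := hε
  have hsub : nearSet D C ∩ slab D S a ε ⊆
      (⋃ i, Metric.cthickening ε (Cs i) ∩ slab D S a ε) ∪ Metric.cthickening ε R := by
    rintro x ⟨⟨q, hq, hxq⟩, hx⟩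
    have hdist : dist x q ≤ ε := hxq ▸ hx.2.2.le
    by_cases hqR : q ∈ R
    · exact Or.inr (Metric.mem_cthickening_of_dist_le _ _ _ _ hqR hdist)
    · have : q ∈ ⋃ i, Metric.thickening ε₀ (Q i) := by
        by_contra hcon
        exact hqR ⟨hCD hq, hcon⟩
      obtain ⟨i, hi⟩ := mem_iUnion.1 this
      exact Or.inl (mem_iUnion.2 ⟨i, Metric.mem_cthickening_of_dist_le _ _ _ _
        ⟨hq, Metric.thickening_subset_cthickening _ _ hi⟩ hdist, hx⟩)
  calc volume (nearSet D C ∩ slab D S a ε)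
      ≤ ∑ i, volume (Metric.cthickening ε (Cs i) ∩ slab D S a ε) +
          volume (Metric.cthickening ε R) := by
        refine (measure_mono hsub).trans ((measure_union_le _ _).trans ?_)
        gcongr
        exact (measure_iUnion_le _).trans_eq (tsum_fintype _)
    _ ≤ ∑ i, (ENNReal.ofReal (1 + t - a) * μHE[n] (Cs i) + τ i) * ENNReal.ofReal ε +
          (M * ENNReal.ofReal t + ENNReal.ofReal t) * ENNReal.ofReal ε := by
        gcongr with i
        exact h1 i
    _ = (ENNReal.ofReal (1 + t - a) * ∑ i, μHE[n] (Cs i) + (∑ i, τ i +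
          (M * ENNReal.ofReal t + ENNReal.ofReal t))) * ENNReal.ofReal ε := by
        rw [← Finset.sum_mul, Finset.sum_add_distrib, ← Finset.mul_sum]
        ring
    _ ≤ c * ENNReal.ofReal ε := by
        gcongr
        refine le_trans ?_ ht.le
        gcongr

/-- The slabs over separated compact pieces are disjoint for small ε, so their lower bounds add up;
the pieces miss at most M t of the Hausdorff measure of D. -/
theorem eventually_le_volume_slab_of_lt {n : ℕ} {D S : Set (Eucl (n + 1))}
    {κ : Measure (Eucl (n + 1))} [IsFiniteMeasure κ] {M : ℝ≥0∞} (hκ : ControlsContent D κ M)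
    (hD : IsCompact D) (hgraph : IsLocalGraphAE D S κ) (hS : IsOpen S) {a : ℝ} (ha : 0 ≤ a)
    {c : ℝ≥0∞} (hc : c < ENNReal.ofReal (1 - a) * μHE[n] D) :
    ∀ᶠ ε in 𝓝[>] (0 : ℝ), c * ENNReal.ofReal ε ≤ volume (slab D S a ε) := by
  have hDfin := hκ.hausdorff_ne_top hD
  have hcfin : c ≠ ⊤ := hc.ne_top
  have ht : Tendsto (fun t : ℝ => ENNReal.ofReal t) (𝓝 0) (𝓝 0) :=
    ENNReal.continuous_ofReal.tendsto' _ _ (by simp)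
  have hlim1 : Tendsto (fun t : ℝ => c * ENNReal.ofReal ((1 + t) ^ n) + M * ENNReal.ofReal t)
      (𝓝[>] 0) (𝓝 c) := by
    refine Tendsto.mono_left ?_ nhdsWithin_le_nhds
    have h1 : Tendsto (fun t : ℝ => ENNReal.ofReal ((1 + t) ^ n)) (𝓝 0) (𝓝 1) :=
      (ENNReal.continuous_ofReal.comp (by fun_prop : Continuous fun t : ℝ => (1 + t) ^ n)).tendsto' _ _
        (by simp)
    have h2 := (ENNReal.Tendsto.const_mul (a := c) h1 (Or.inr hcfin)).add
      (ENNReal.Tendsto.const_mul (a := M) ht (Or.inr hκ.ne_top))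
    simpa using h2
  have hlim2 : Tendsto (fun t : ℝ => ENNReal.ofReal (1 - (1 + t) * a) * μHE[n] D) (𝓝[>] 0)
      (𝓝 (ENNReal.ofReal (1 - a) * μHE[n] D)) := by
    refine Tendsto.mono_left ?_ nhdsWithin_le_nhds
    have h1 : Tendsto (fun t : ℝ => ENNReal.ofReal (1 - (1 + t) * a)) (𝓝 0)
        (𝓝 (ENNReal.ofReal (1 - a))) :=
      (ENNReal.continuous_ofReal.comp
        (by fun_prop : Continuous fun t : ℝ => 1 - (1 + t) * a)).tendsto' _ _ (by simp)
    exact ENNReal.Tendsto.mul_const h1 (Or.inr hDfin)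
  obtain ⟨t, ht, ht0⟩ := ((hlim1.eventually_lt hlim2 hc).and self_mem_nhdsWithin).exists
  have ht0 : 0 < t := ht0
  have hT : 0 < ENNReal.ofReal t := ENNReal.ofReal_pos.2 ht0
  obtain ⟨N, Q, U, hQ, hQD, hQU, hUo, hUg, hdisj, hκQ⟩ :=
    hgraph.exists_decomposition (δ := t.toNNReal) (Real.toNNReal_pos.2 ht0) hT
  have hsum : μHE[n] D ≤ ∑ i, μHE[n] (Q i) + M * ENNReal.ofReal t := by
    have h1 : D ⊆ (⋃ i, Q i) ∪ (D \ ⋃ i, Q i) := by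
      rw [union_sdiff_self]; exact subset_union_right
    refine (measure_mono h1).trans ((measure_union_le _ _).trans (add_le_add ?_ ?_))
    · exact (measure_iUnion_le _).trans_eq (tsum_fintype _)
    · refine (hκ.hausdorff_le _ sdiff_subset (hD.isClosed.measurableSet.diff
        (MeasurableSet.iUnion fun i => (hQ i).isClosed.measurableSet))).trans ?_
      gcongr
  have hpiece : ∀ᶠ ε in 𝓝[>] (0 : ℝ), ∀ i,
      ENNReal.ofReal (1 - (1 + t) * a) * μHE[n] (Q i) * ENNReal.ofReal ε ≤
      ENNReal.ofReal (1 + t) ^ n * volume (Metric.thickening ε (Q i) ∩ slab D S a ε) := by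
    refine eventually_all.2 fun i => ?_
    obtain ⟨L, ψ, hψ, hg⟩ := hUg i
    have := eventually_le_volume_slab hψ (hUo i) hg hD.isClosed (hQ i) (hQD i) (hQU i) ha
    rwa [Real.coe_toNNReal _ ht0.le] at this
  have hsep : ∀ᶠ ε in 𝓝[>] (0 : ℝ), ∀ i j, i ≠ j →
      Disjoint (Metric.thickening ε (Q i)) (Metric.thickening ε (Q j)) := by
    refine eventually_all.2 fun i => eventually_all.2 fun j => ?_
    by_cases hij : i = j
    · simp [hij]
    obtain ⟨r, hr, hd⟩ := (hdisj hij).exists_thickenings (hQ i) (hQ j).isClosed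
    filter_upwards [Ioo_mem_nhdsGT hr] with ε hε _
    exact hd.mono (Metric.thickening_mono hε.2.le _) (Metric.thickening_mono hε.2.le _)
  filter_upwards [hpiece, hsep] with ε h1 h2
  have hvol : ∑ i, volume (Metric.thickening ε (Q i) ∩ slab D S a ε) ≤ volume (slab D S a ε) := by
    have := measure_iUnion (μ := volume) (f := fun i => Metric.thickening ε (Q i) ∩ slab D S a ε)
      (fun i j hij => (h2 i j hij).mono inter_subset_left inter_subset_left)
      (fun i => Metric.isOpen_thickening.measurableSet.inter (measurableSet_slab hS a ε))
    rw [tsum_fintype] at this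
    rw [← this]
    exact measure_mono (iUnion_subset fun i => inter_subset_right)
  have h3 : ENNReal.ofReal (1 - (1 + t) * a) * μHE[n] D * ENNReal.ofReal ε ≤
      ENNReal.ofReal (1 + t) ^ n * volume (slab D S a ε) +
        M * ENNReal.ofReal t * ENNReal.ofReal ε := by
    calc _ ≤ ENNReal.ofReal (1 - (1 + t) * a) *
            (∑ i, μHE[n] (Q i) + M * ENNReal.ofReal t) * ENNReal.ofReal ε := by gcongr
      _ = ∑ i, ENNReal.ofReal (1 - (1 + t) * a) * μHE[n] (Q i) * ENNReal.ofReal ε +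
            ENNReal.ofReal (1 - (1 + t) * a) * (M * ENNReal.ofReal t * ENNReal.ofReal ε) := by
          rw [← Finset.sum_mul, ← Finset.mul_sum]
          ring
      _ ≤ ∑ i, ENNReal.ofReal (1 + t) ^ n * volume (Metric.thickening ε (Q i) ∩ slab D S a ε) +
            M * ENNReal.ofReal t * ENNReal.ofReal ε := by
          refine add_le_add (Finset.sum_le_sum fun i _ => h1 i) ?_
          · refine mul_le_of_le_one_left zero_le ?_
            rw [ENNReal.ofReal_le_one]
            have : 0 ≤ (1 + t) * a := by positivity
            linarith
      _ ≤ _ := by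
          rw [← Finset.mul_sum]
          gcongr
  have h4 : ENNReal.ofReal (1 + t) ^ n * (c * ENNReal.ofReal ε) +
      M * ENNReal.ofReal t * ENNReal.ofReal ε ≤ ENNReal.ofReal (1 + t) ^ n *
        volume (slab D S a ε) + M * ENNReal.ofReal t * ENNReal.ofReal ε := by
    refine le_trans ?_ h3
    rw [← ENNReal.ofReal_pow (by positivity)]
    calc _ = (c * ENNReal.ofReal ((1 + t) ^ n) + M * ENNReal.ofReal t) * ENNReal.ofReal ε := by ring
      _ ≤ _ := by gcongr
  have h5 := (ENNReal.add_le_add_iff_right (ENNReal.mul_ne_top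
    (ENNReal.mul_ne_top hκ.ne_top ENNReal.ofReal_ne_top) ENNReal.ofReal_ne_top)).1 h4
  rw [← ENNReal.ofReal_pow (by positivity)] at h5
  exact (ENNReal.mul_le_mul_iff_right (by simpa using pow_pos (by positivity : 0 < 1 + t) n)
    ENNReal.ofReal_ne_top).1 h5

end BoundaryRD

/-! ### Density bounds for the distance to the boundary -/

namespace BoundaryRD

open scoped ENNReal NNReal

/-- `S` is one side of the compact hypersurface `D`, which is regular up to a set that is negligible
for `κ`. -/
structure IsSide {n : ℕ} (D S : Set (Eucl (n + 1))) (κ : Measure (Eucl (n + 1)))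
    (M : ℝ≥0∞) : Prop where
  isCompact : IsCompact D
  nonempty : D.Nonempty
  isOpen : IsOpen S
  disjoint : Disjoint S D
  frontier_subset : frontier S ⊆ D
  control : ControlsContent D κ M
  graph : IsLocalGraphAE D S κ

variable {n : ℕ} {D S : Set (Eucl (n + 1))} {κ : Measure (Eucl (n + 1))}
  {M : ℝ≥0∞}

theorem map_infDist_restrict_apply {N : Set (Eucl (n + 1))} {B : Set ℝ}
    (hB : MeasurableSet B) :
    (volume.restrict (S ∩ N)).map (Metric.infDist · D) B =
      volume (S ∩ N ∩ (Metric.infDist · D) ⁻¹' B) := by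
  have hd : Measurable (Metric.infDist · D) := (Metric.continuous_infDist_pt D).measurable
  rw [Measure.map_apply hd hB, Measure.restrict_apply (hd hB), inter_comm]

/-- Kneser's property for the law of the distance, in the form that the dilation lemmas take. -/
theorem IsSide.map_infDist_le (h : IsSide D S κ M) {C : Set (Eucl (n + 1))} (hCD : C ⊆ D)
    (l : ℝ) (hl : 1 ≤ l) (B : Set ℝ) (hB : MeasurableSet B) :
    (volume.restrict (S ∩ nearSet D C)).map (Metric.infDist · D) B ≤ ENNReal.ofReal l ^ (n + 1) *
      (volume.restrict (S ∩ nearSet D C)).map (Metric.infDist · D) ((l * ·) ⁻¹' B) := by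
  rw [map_infDist_restrict_apply hB, map_infDist_restrict_apply
    ((measurable_const_mul l) hB)]
  exact volume_nearSet_le h.isOpen h.disjoint h.frontier_subset h.isCompact.isClosed hCD hl

variable [IsFiniteMeasure κ]

/-- The distance to `D`, on the points of `S` whose nearest point lies in `C`, has near `0` a density
that is essentially bounded by any number greater than the Hausdorff measure of `C`. -/
theorem IsSide.exists_volume_nearSet_le (h : IsSide D S κ M) {C : Set (Eucl (n + 1))}
    (hC : IsClosed C) (hCD : C ⊆ D) {c : ℝ≥0∞} (hc : μHE[n] C < c) :
    ∃ ε₀ > 0, ∀ B : Set ℝ, MeasurableSet B → B ⊆ Ioo 0 ε₀ →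
      volume (S ∩ nearSet D C ∩ (Metric.infDist · D) ⁻¹' B) ≤ c * volume B := by
  have hlim : Tendsto (fun a : ℝ => ENNReal.ofReal (a ^ (n + 1)) * c) (𝓝[<] 1) (𝓝 c) := by
    refine Tendsto.mono_left ?_ nhdsWithin_le_nhds
    have h1 : Tendsto (fun a : ℝ => ENNReal.ofReal (a ^ (n + 1))) (𝓝 1) (𝓝 1) :=
      (ENNReal.continuous_ofReal.comp (continuous_pow (n + 1))).tendsto' _ _ (by simp)
    simpa using ENNReal.Tendsto.mul_const (b := c) h1 (Or.inl one_ne_zero)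
  -- With a close to 1, the loss a ^ (n + 1) of the dilation argument fits into the gap between the
  -- Hausdorff measure of C and c.
  obtain ⟨a, ha, ha0, ha1⟩ := ((hlim.eventually (lt_mem_nhds hc)).and
    (Ioo_mem_nhdsLT (zero_lt_one (α := ℝ)))).exists
  have hpos : 0 < (1 - a) * a ^ (n + 1) := mul_pos (by linarith) (by positivity)
  have hc1 : ENNReal.ofReal (1 - a) * μHE[n] C < ENNReal.ofReal ((1 - a) * a ^ (n + 1)) * c := by
    rw [ENNReal.ofReal_mul (by linarith), mul_assoc]
    exact (ENNReal.mul_lt_mul_iff_right (by simpa using ha1) ENNReal.ofReal_ne_top).2 ha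
  have hev := eventually_volume_nearSet_slab_le h.control h.isCompact h.graph hC hCD hc1
  obtain ⟨ε₀, hε₀, hI⟩ := mem_nhdsGT_iff_exists_Ioo_subset.1 hev
  refine ⟨ε₀, hε₀, fun B hB hB0 => ?_⟩
  have key := measure_le_of_dilation (fun l hl B hB _ => h.map_infDist_le hCD l hl B hB) ha0 ha1
    (ε₀ := ε₀) (c := ENNReal.ofReal ((1 - a) * a ^ (n + 1)) * c) (fun ε hε => by
      rw [map_infDist_restrict_apply measurableSet_Ioo]
      refine (measure_mono ?_).trans (hI hε)
      rintro x ⟨⟨h1, h2⟩, h3⟩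
      exact ⟨h2, h1, h3⟩) hB hB0
  rw [map_infDist_restrict_apply hB, mul_assoc] at key
  exact (ENNReal.mul_le_mul_iff_right (by simpa using hpos) ENNReal.ofReal_ne_top).1 key

theorem nearSet_self (hD : IsClosed D) (hne : D.Nonempty) : nearSet D D = univ :=
  eq_univ_of_forall fun x => exists_nearest hD hne x

/-- The slab lower bound transferred to arbitrary B by `le_measure_of_dilation`, again with a close
to 1. -/
theorem IsSide.exists_le_volume (h : IsSide D S κ M) {c : ℝ≥0∞} (hc : c < μHE[n] D) :
    ∃ ε₀ > 0, ∀ B : Set ℝ, MeasurableSet B → B ⊆ Ioo 0 ε₀ →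
      c * volume B ≤ volume (S ∩ (Metric.infDist · D) ⁻¹' B) := by
  have hlim : Tendsto (fun a : ℝ => c * ENNReal.ofReal (a ^ (n + 1))⁻¹) (𝓝[<] 1) (𝓝 c) := by
    refine Tendsto.mono_left ?_ nhdsWithin_le_nhds
    have h0 : Tendsto (fun a : ℝ => (a ^ (n + 1))⁻¹) (𝓝 1) (𝓝 1) := by
      have := ((continuous_pow (n + 1)).tendsto (1 : ℝ)).inv₀ (by simp)
      simpa using this
    have h1 : Tendsto (fun a : ℝ => ENNReal.ofReal (a ^ (n + 1))⁻¹) (𝓝 1) (𝓝 1) := by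
      have := (ENNReal.continuous_ofReal.tendsto 1).comp h0
      rwa [ENNReal.ofReal_one] at this
    simpa using ENNReal.Tendsto.const_mul (a := c) h1 (Or.inr hc.ne_top)
  obtain ⟨a, ha, ha0, ha1⟩ := ((hlim.eventually (gt_mem_nhds hc)).and
    (Ioo_mem_nhdsLT (zero_lt_one (α := ℝ)))).exists
  have hone : ENNReal.ofReal (1 - a) ≠ 0 := by simpa using ha1
  have hc1 : ENNReal.ofReal (1 - a) * (c * ENNReal.ofReal (a ^ (n + 1))⁻¹) <
      ENNReal.ofReal (1 - a) * μHE[n] D :=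
    (ENNReal.mul_lt_mul_iff_right hone ENNReal.ofReal_ne_top).2 ha
  have hev := eventually_le_volume_slab_of_lt h.control h.isCompact h.graph h.isOpen ha0.le hc1
  obtain ⟨ε₀, hε₀, hI⟩ := mem_nhdsGT_iff_exists_Ioo_subset.1 hev
  refine ⟨a * ε₀, mul_pos ha0 hε₀, fun B hB hB0 => ?_⟩
  have hS : S ∩ nearSet D D = S := by
    rw [nearSet_self h.isCompact.isClosed h.nonempty, inter_univ]
  have key := le_measure_of_dilation (fun l hl B hB _ => h.map_infDist_le subset_rfl l hl B hB) ha0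
    (ε₀ := ε₀) (c := ENNReal.ofReal (1 - a) * (c * ENNReal.ofReal (a ^ (n + 1))⁻¹))
    (fun ε hε => by
      rw [map_infDist_restrict_apply measurableSet_Ioo, hS]
      exact hI hε) hB hB0
  rw [map_infDist_restrict_apply hB, hS] at key
  refine (ENNReal.mul_le_mul_iff_right hone ENNReal.ofReal_ne_top).1 (le_trans (le_of_eq ?_) key)
  calc _ = ENNReal.ofReal (1 - a) * (c * volume B) * 1 := by ring
    _ = ENNReal.ofReal (1 - a) * (c * volume B) *
          (ENNReal.ofReal (a ^ (n + 1)) * ENNReal.ofReal (a ^ (n + 1))⁻¹) := by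
        rw [← ENNReal.ofReal_mul (by positivity), mul_inv_cancel₀ (by positivity),
          ENNReal.ofReal_one]
    _ = _ := by ring

/-- Continuity in the ambient space at every point of a compact set is uniform there, and it also
compares f at points off D with f at nearby points of D. -/
theorem exists_uniform_dist_lt {D : Set (Eucl (n + 1))} (hD : IsCompact D)
    {f : Eucl (n + 1) → ℝ} (hf : ∀ x ∈ D, ContinuousAt f x) {θ : ℝ} (hθ : 0 < θ) :
    ∃ r > 0, ∀ q ∈ D, ∀ x, dist x q < r → |f x - f q| < θ := by
  have := hD.uniformContinuousAt_of_continuousAt f hf (Metric.dist_mem_uniformity hθ)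
  obtain ⟨r, hr, h⟩ := Metric.mem_uniformity_dist.1 this
  refine ⟨r, hr, fun q hq x hx => ?_⟩
  have h2 := h (a := q) (b := x) (by rwa [dist_comm]) hq
  rw [← Real.dist_eq, dist_comm]
  exact h2

/-- Layer cake approximation of a nonnegative number by a staircase of step `θ`. -/
theorem sum_range_levels {θ y : ℝ} (hθ : 0 < θ) (hy : 0 ≤ y) {k : ℕ} (hk : y ≤ k * θ) :
    (∑ i ∈ Finset.range k, if ((i : ℝ) + 1) * θ ≤ y then ENNReal.ofReal θ else 0) ≤
      ENNReal.ofReal y ∧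
    ENNReal.ofReal y ≤ ENNReal.ofReal θ +
      ∑ i ∈ Finset.range k, if ((i : ℝ) + 1) * θ ≤ y then ENNReal.ofReal θ else 0 := by
  have hyθ : 0 ≤ y / θ := by positivity
  set j := ⌊y / θ⌋₊ with hj
  have hjk : j ≤ k := by
    have : y / θ ≤ k := (div_le_iff₀ hθ).2 hk
    exact (Nat.floor_le_floor this).trans_eq (Nat.floor_natCast k)
  have hiff : ∀ i : ℕ, ((i : ℝ) + 1) * θ ≤ y ↔ i < j := by
    intro i
    rw [← le_div_iff₀ hθ, ← Nat.succ_le_iff, hj, Nat.le_floor_iff hyθ]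
    push_cast
    rfl
  have hsum : (∑ i ∈ Finset.range k, if ((i : ℝ) + 1) * θ ≤ y then ENNReal.ofReal θ else 0) =
      ENNReal.ofReal (j * θ) := by
    simp only [hiff]
    rw [← Finset.sum_filter]
    have : (Finset.range k).filter (· < j) = Finset.range j := by
      ext i
      simp only [Finset.mem_filter, Finset.mem_range]
      omega
    rw [this, Finset.sum_const, Finset.card_range, ENNReal.ofReal_mul (by positivity),
      ENNReal.ofReal_natCast, nsmul_eq_mul]
  rw [hsum]
  constructor
  · exact ENNReal.ofReal_le_ofReal ((le_div_iff₀ hθ).1 (Nat.floor_le hyθ))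
  · rw [← ENNReal.ofReal_add hθ.le (by positivity)]
    refine ENNReal.ofReal_le_ofReal ?_
    have := (div_lt_iff₀ hθ).1 (Nat.lt_floor_add_one (y / θ))
    rw [← hj] at this
    linarith

/-- Near D the value f(x) is close to f at a nearest point q, and f(q) is approximated by a
staircase over the closed superlevel sets of f on D. Each step of the staircase is a `nearSet` and
obeys the density bound, and the steps sum back to the surface integral. -/
theorem IsSide.exists_lintegral_le (h : IsSide D S κ M) {f : Eucl (n + 1) → ℝ}
    (hf0 : ∀ x, 0 ≤ f x) (hf : ∀ x ∈ D, ContinuousAt f x) {c : ℝ≥0∞}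
    (hc : ∫⁻ x in D, ENNReal.ofReal (f x) ∂μHE[n] < c) :
    ∃ ε₀ > 0, ∀ B : Set ℝ, MeasurableSet B → B ⊆ Ioo 0 ε₀ →
      ∫⁻ x in S ∩ (Metric.infDist · D) ⁻¹' B, ENNReal.ofReal (f x) ≤ c * volume B := by
  have hDcl := h.isCompact.isClosed
  have hDfin := h.control.hausdorff_ne_top h.isCompact
  have hfD : ContinuousOn f D := fun x hx => (hf x hx).continuousWithinAt
  obtain ⟨b, hb⟩ := h.isCompact.bddAbove_image hfD
  have hlim : Tendsto (fun t : ℝ => ∫⁻ x in D, ENNReal.ofReal (f x) ∂μHE[n] + (ENNReal.ofReal t +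
      2 * ENNReal.ofReal t * (μHE[n] D + 1))) (𝓝[>] 0)
      (𝓝 (∫⁻ x in D, ENNReal.ofReal (f x) ∂μHE[n])) := by
    refine Tendsto.mono_left ?_ nhdsWithin_le_nhds
    have ht : Tendsto (fun t : ℝ => ENNReal.ofReal t) (𝓝 0) (𝓝 0) :=
      ENNReal.continuous_ofReal.tendsto' _ _ (by simp)
    have h1 := ENNReal.Tendsto.mul_const (b := μHE[n] D + 1)
      (ENNReal.Tendsto.const_mul (a := 2) ht (Or.inr (by simp))) (Or.inr (by simpa using hDfin))
    have h2 := (ht.add h1).const_add (∫⁻ x in D, ENNReal.ofReal (f x) ∂μHE[n])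
    simpa using h2
  obtain ⟨θ, hθc, hθ⟩ := ((hlim.eventually (gt_mem_nhds hc)).and self_mem_nhdsWithin).exists
  have hθ : 0 < θ := hθ
  obtain ⟨k, hk⟩ := exists_nat_ge (b / θ)
  have hk : ∀ x ∈ D, f x ≤ k * θ := fun x hx =>
    (hb (mem_image_of_mem f hx)).trans ((div_le_iff₀ hθ).1 hk)
  let A : ℕ → Set (Eucl (n + 1)) := fun i => {x | x ∈ D ∧ ((i : ℝ) + 1) * θ ≤ f x}
  have hAD : ∀ i, A i ⊆ D := fun i x hx => hx.1
  have hAcl : ∀ i, IsClosed (A i) := fun i => by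
    have := hfD.preimage_isClosed_of_isClosed hDcl (isClosed_Ici (a := ((i : ℝ) + 1) * θ))
    exact this
  have hAfin : ∀ i, μHE[n] (A i) ≠ ⊤ := fun i =>
    ((measure_mono (hAD i)).trans_lt hDfin.lt_top).ne
  obtain ⟨τ, hτ, hτsum⟩ := ENNReal.exists_pos_sum_of_countable' (one_ne_zero (α := ℝ≥0∞)) ℕ
  choose e he0 he using fun i => h.exists_volume_nearSet_le (hAcl i) (hAD i)
    (c := μHE[n] (A i) + τ i) (ENNReal.lt_add_right (hAfin i) (hτ i).ne')
  obtain ⟨eD, heD0, heD⟩ := h.exists_volume_nearSet_le hDcl subset_rfl (c := μHE[n] D + 1)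
    (ENNReal.lt_add_right hDfin one_ne_zero)
  rw [nearSet_self hDcl h.nonempty, inter_univ] at heD
  obtain ⟨r, hr, hunif⟩ := exists_uniform_dist_lt h.isCompact hf hθ
  have hev : ∀ᶠ ε in 𝓝[>] (0 : ℝ), ε < r ∧ ε < eD ∧ ∀ i ∈ Finset.range k, ε < e i := by
    have h1 : ∀ {y : ℝ}, 0 < y → ∀ᶠ ε in 𝓝[>] (0 : ℝ), ε < y := fun hy =>
      (gt_mem_nhds hy).filter_mono nhdsWithin_le_nhds
    refine (h1 hr).and ((h1 heD0).and ?_)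
    rw [Filter.eventually_all_finset]
    exact fun i _ => h1 (he0 i)
  obtain ⟨ε₀, ⟨h1, h2, h3⟩, hε₀⟩ := (hev.and self_mem_nhdsWithin).exists
  refine ⟨ε₀, hε₀, fun B hB hB0 => ?_⟩
  set Z := S ∩ (Metric.infDist · D) ⁻¹' B with hZ
  have hdm : Measurable (Metric.infDist · D) := (Metric.continuous_infDist_pt D).measurable
  have hZm : MeasurableSet Z := h.isOpen.measurableSet.inter (hdm hB)
  have hNm : ∀ i, MeasurableSet (nearSet D (A i)) := fun i =>
    (isClosed_nearSet (h.isCompact.of_isClosed_subset (hAcl i) (hAD i)) (hAD i)).measurableSet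
  -- One θ pays for passing from x to q, the other for the staircase.
  have hpt : ∀ x ∈ Z, ENNReal.ofReal (f x) ≤ 2 * ENNReal.ofReal θ +
      ∑ i ∈ Finset.range k, (nearSet D (A i)).indicator (fun _ => ENNReal.ofReal θ) x := by
    intro x hx
    obtain ⟨q, hq, hxq⟩ := exists_nearest hDcl h.nonempty x
    have hd : dist x q < r := by rw [hxq]; exact (hB0 hx.2).2.trans h1
    have hfx : f x ≤ θ + f q := by
      have := (abs_lt.1 (hunif q hq x hd)).2
      linarith
    refine (ENNReal.ofReal_le_ofReal hfx).trans ?_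
    rw [ENNReal.ofReal_add hθ.le (hf0 q), two_mul, add_assoc]
    gcongr
    refine (sum_range_levels hθ (hf0 q) (hk q hq)).2.trans ?_
    gcongr with i
    split_ifs with hi
    · rw [indicator_of_mem (show x ∈ nearSet D (A i) from ⟨q, ⟨hq, hi⟩, hxq⟩)]
    · exact zero_le
  have hlow : ∑ i ∈ Finset.range k, ENNReal.ofReal θ * μHE[n] (A i) ≤
      ∫⁻ x in D, ENNReal.ofReal (f x) ∂μHE[n] := by
    calc _ = ∑ i ∈ Finset.range k, ∫⁻ x in D, (A i).indicator (fun _ => ENNReal.ofReal θ) x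
            ∂μHE[n] := by
          refine Finset.sum_congr rfl fun i _ => ?_
          rw [lintegral_indicator_const (hAcl i).measurableSet,
            Measure.restrict_eq_self _ (hAD i)]
      _ = ∫⁻ x in D, ∑ i ∈ Finset.range k, (A i).indicator (fun _ => ENNReal.ofReal θ) x
            ∂μHE[n] := by
          rw [lintegral_finsetSum]
          exact fun i _ => measurable_const.indicator (hAcl i).measurableSet
      _ ≤ _ := by
          refine setLIntegral_mono' hDcl.measurableSet fun x hx => ?_
          refine le_trans (le_of_eq ?_) (sum_range_levels hθ (hf0 x) (hk x hx)).1
          refine Finset.sum_congr rfl fun i _ => ?_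
          by_cases hi : ((i : ℝ) + 1) * θ ≤ f x
          · rw [if_pos hi, indicator_of_mem (show x ∈ A i from ⟨hx, hi⟩)]
          · rw [if_neg hi, indicator_of_notMem (fun hx' : x ∈ A i => hi hx'.2)]
  calc ∫⁻ x in Z, ENNReal.ofReal (f x)
      ≤ ∫⁻ x in Z, (2 * ENNReal.ofReal θ +
          ∑ i ∈ Finset.range k, (nearSet D (A i)).indicator (fun _ => ENNReal.ofReal θ) x) :=
        setLIntegral_mono' hZm hpt
    _ = 2 * ENNReal.ofReal θ * volume Z +
          ∑ i ∈ Finset.range k, ENNReal.ofReal θ * volume (nearSet D (A i) ∩ Z) := by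
        rw [lintegral_add_left measurable_const, setLIntegral_const, lintegral_finsetSum]
        · congr 1
          refine Finset.sum_congr rfl fun i _ => ?_
          rw [lintegral_indicator_const (hNm i), Measure.restrict_apply (hNm i)]
        · exact fun i _ => measurable_const.indicator (hNm i)
    _ ≤ 2 * ENNReal.ofReal θ * ((μHE[n] D + 1) * volume B) +
          ∑ i ∈ Finset.range k, ENNReal.ofReal θ * ((μHE[n] (A i) + τ i) * volume B) := by
        gcongr with i hi
        · exact heD B hB fun y hy => ⟨(hB0 hy).1, (hB0 hy).2.trans h2⟩
        · refine le_trans (measure_mono ?_)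
            (he i B hB fun y hy => ⟨(hB0 hy).1, (hB0 hy).2.trans (h3 i hi)⟩)
          rintro x ⟨hx1, hx2, hx3⟩
          exact ⟨⟨hx2, hx1⟩, hx3⟩
    _ = (∑ i ∈ Finset.range k, ENNReal.ofReal θ * μHE[n] (A i) +
          (ENNReal.ofReal θ * ∑ i ∈ Finset.range k, τ i +
            2 * ENNReal.ofReal θ * (μHE[n] D + 1))) * volume B := by
        simp only [← mul_assoc]
        rw [← Finset.sum_mul]
        simp only [mul_add, Finset.sum_add_distrib, ← Finset.mul_sum]
        ring
    _ ≤ (∫⁻ x in D, ENNReal.ofReal (f x) ∂μHE[n] + (ENNReal.ofReal θ * 1 +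
            2 * ENNReal.ofReal θ * (μHE[n] D + 1))) * volume B := by
        gcongr
        exact (ENNReal.sum_le_tsum _).trans hτsum.le
    _ ≤ c * volume B := by
        rw [mul_one]
        gcongr

end BoundaryRD

/-! ### Two-sided approximation of integrals over parallel sets -/

namespace BoundaryRD

open scoped ENNReal NNReal

variable {n : ℕ} {D S : Set (Eucl (n + 1))} {κ : Measure (Eucl (n + 1))} [IsFiniteMeasure κ]
  {M : ℝ≥0∞}

theorem lintegral_ofReal_max_add {V : Type*} [MeasurableSpace V] {μ : Measure V} {Z : Set V}
    (hZ : MeasurableSet Z) (hfin : μ Z ≠ ⊤) {g : V → ℝ} (hg : IntegrableOn g Z μ) {b : ℝ}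
    (hb : ∀ x ∈ Z, |g x| ≤ b) :
    ∫⁻ x in Z, ENNReal.ofReal (max (b + g x) 0) ∂μ =
      ENNReal.ofReal (b * μ.real Z + ∫ x in Z, g x ∂μ) := by
  have : IsFiniteMeasure (μ.restrict Z) := ⟨by simpa using hfin.lt_top⟩
  have h0 : ∀ x ∈ Z, 0 ≤ b + g x := fun x hx => by
    have := neg_le_of_abs_le (hb x hx)
    linarith
  have h1 : ∫⁻ x in Z, ENNReal.ofReal (max (b + g x) 0) ∂μ =
      ∫⁻ x in Z, ENNReal.ofReal (b + g x) ∂μ :=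
    setLIntegral_congr_fun hZ fun x hx => by rw [max_eq_left (h0 x hx)]
  rw [h1, ← ofReal_integral_eq_lintegral_ofReal (f := fun x => b + g x)
    ((integrable_const b).add hg) (ae_restrict_of_forall_mem hZ h0),
    integral_add (integrable_const b) hg, setIntegral_const, smul_eq_mul, mul_comm b]

theorem IsSide.exists_le_volume_real (h : IsSide D S κ M) {η : ℝ} (hη : 0 < η) :
    ∃ ε₀ > 0, ∀ B : Set ℝ, MeasurableSet B → B ⊆ Ioo 0 ε₀ →
      volume (S ∩ (Metric.infDist · D) ⁻¹' B) ≠ ⊤ ∧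
      (μHE[n].real D - η) * volume.real B ≤ volume.real (S ∩ (Metric.infDist · D) ⁻¹' B) := by
  have hDfin := h.control.hausdorff_ne_top h.isCompact
  obtain ⟨e1, he1, H1⟩ := h.exists_volume_nearSet_le h.isCompact.isClosed subset_rfl
    (c := μHE[n] D + 1) (ENNReal.lt_add_right hDfin one_ne_zero)
  rw [nearSet_self h.isCompact.isClosed h.nonempty, inter_univ] at H1
  have hBfin : ∀ {B : Set ℝ} {ε : ℝ}, B ⊆ Ioo 0 ε → volume B ≠ ⊤ := fun hB =>
    ((measure_mono hB).trans_lt (by simp)).ne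
  have hfin : ∀ B : Set ℝ, MeasurableSet B → B ⊆ Ioo 0 e1 →
      volume (S ∩ (Metric.infDist · D) ⁻¹' B) ≠ ⊤ := fun B hB hB1 =>
    ((H1 B hB hB1).trans_lt (ENNReal.mul_lt_top (by simpa using hDfin.lt_top)
      (hBfin hB1).lt_top)).ne
  -- If D has measure 0 there is no c below it, but then the bound is trivial.
  rcases (measureReal_nonneg (μ := μHE[n]) (s := D)).eq_or_lt with h0 | h0
  · refine ⟨e1, he1, fun B hB hB1 => ⟨hfin B hB hB1, ?_⟩⟩
    rw [← h0]
    have : 0 ≤ η * volume.real B := by positivity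
    have h2 := measureReal_nonneg (μ := volume) (s := S ∩ (Metric.infDist · D) ⁻¹' B)
    linarith
  · obtain ⟨e2, he2, H2⟩ := h.exists_le_volume (c := ENNReal.ofReal (μHE[n].real D - η)) (by
      rw [← ofReal_measureReal hDfin, ENNReal.ofReal_lt_ofReal_iff h0]
      linarith)
    refine ⟨min e1 e2, lt_min he1 he2, fun B hB hB0 => ?_⟩
    have hB1 : B ⊆ Ioo 0 e1 := hB0.trans (Ioo_subset_Ioo_right (min_le_left _ _))
    have hB2 : B ⊆ Ioo 0 e2 := hB0.trans (Ioo_subset_Ioo_right (min_le_right _ _))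
    refine ⟨hfin B hB hB1, ?_⟩
    have h3 := ENNReal.toReal_mono (hfin B hB hB1) (H2 B hB hB2)
    rw [ENNReal.toReal_mul] at h3
    refine le_trans (mul_le_mul_of_nonneg_right ?_ measureReal_nonneg) h3
    rw [ENNReal.toReal_ofReal']
    exact le_max_left _ _

/-- The integrals of a function over the parallel sets of `D` inside `S` have density close to the
surface integral of the function. -/
theorem IsSide.exists_integral_approx (h : IsSide D S κ M) {f : Eucl (n + 1) → ℝ}
    (hfm : Measurable f) (hf : ∀ x ∈ D, ContinuousAt f x) {η : ℝ} (hη : 0 < η) :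
    ∃ ε₀ > 0, ∀ B : Set ℝ, MeasurableSet B → B ⊆ Ioo 0 ε₀ →
      IntegrableOn f (S ∩ (Metric.infDist · D) ⁻¹' B) ∧
      |(∫ x in S ∩ (Metric.infDist · D) ⁻¹' B, f x) - (∫ x in D, f x ∂μHE[n]) * volume.real B| ≤
        η * volume.real B := by
  have hDcl := h.isCompact.isClosed
  have hDfin := h.control.hausdorff_ne_top h.isCompact
  have hfinD : IsFiniteMeasure (μHE[n].restrict D) := ⟨by simpa using hDfin.lt_top⟩
  have hfD : ContinuousOn f D := fun x hx => (hf x hx).continuousWithinAt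
  have hfint : IntegrableOn f D μHE[n] := by
    obtain ⟨b, hb⟩ := h.isCompact.exists_bound_of_continuousOn hfD
    exact Measure.integrableOn_of_bounded hDfin hfm.aestronglyMeasurable
      (ae_restrict_of_forall_mem hDcl.measurableSet hb)
  obtain ⟨b, hb0, r, hr, hbr⟩ : ∃ b : ℝ, 0 ≤ b ∧ ∃ r > 0, ∀ x, Metric.infDist x D < r → |f x| ≤ b := by
    obtain ⟨b, hb⟩ := h.isCompact.exists_bound_of_continuousOn hfD
    obtain ⟨r, hr, hu⟩ := exists_uniform_dist_lt h.isCompact hf one_pos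
    refine ⟨|b| + 1, by positivity, r, hr, fun x hx => ?_⟩
    obtain ⟨q, hq, hxq⟩ := exists_nearest hDcl h.nonempty x
    have h1 := hu q hq x (hxq ▸ hx)
    have h2 := hb q hq
    rw [Real.norm_eq_abs] at h2
    have h3 : |f x| ≤ |f x - f q| + |f q| := by
      simpa using abs_add_le (f x - f q) (f q)
    linarith [le_abs_self b]
  have hbD : ∀ x ∈ D, |f x| ≤ b := fun x hx => hbr x (by rwa [Metric.infDist_zero_of_mem hx])
  set m := μHE[n].real D with hm
  set I := ∫ x in D, f x ∂μHE[n] with hI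
  -- Budget: η' for the integral of b ± f and b η' for the volume term that is subtracted, in total
  -- η.
  set η' := η / (1 + b) with hη'
  have hη'0 : 0 < η' := by positivity
  have upper : ∀ g : Eucl (n + 1) → ℝ, Measurable g → (∀ x ∈ D, ContinuousAt g x) →
      (∀ x, Metric.infDist x D < r → |g x| ≤ b) → IntegrableOn g D μHE[n] →
      ∃ ε₀ > 0, ∀ B : Set ℝ, MeasurableSet B → B ⊆ Ioo 0 ε₀ →
        volume (S ∩ (Metric.infDist · D) ⁻¹' B) ≠ ⊤ →
        IntegrableOn g (S ∩ (Metric.infDist · D) ⁻¹' B) ∧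
        b * volume.real (S ∩ (Metric.infDist · D) ⁻¹' B) +
          ∫ x in S ∩ (Metric.infDist · D) ⁻¹' B, g x ≤
          (b * m + ∫ x in D, g x ∂μHE[n] + η') * volume.real B := by
    intro g hgm hg hgb hgint
    have hgD : ∀ x ∈ D, |g x| ≤ b := fun x hx => hgb x (by rwa [Metric.infDist_zero_of_mem hx])
    have e1 : ∫⁻ x in D, ENNReal.ofReal (max (b + g x) 0) ∂μHE[n] =
        ENNReal.ofReal (b * m + ∫ x in D, g x ∂μHE[n]) :=
      lintegral_ofReal_max_add hDcl.measurableSet hDfin hgint hgD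
    have hnn : 0 ≤ b * m + ∫ x in D, g x ∂μHE[n] := by
      have h1 : ∫ x in D, -b ∂μHE[n] ≤ ∫ x in D, g x ∂μHE[n] :=
        setIntegral_mono_on (integrable_const _) hgint hDcl.measurableSet fun x hx =>
          neg_le_of_abs_le (hgD x hx)
      rw [setIntegral_const, smul_eq_mul] at h1
      linarith
    -- Truncation at 0: b + g is nonnegative only near D, whereas the upper bound requires it
    -- everywhere.
    obtain ⟨e, he, H⟩ := h.exists_lintegral_le (f := fun x => max (b + g x) 0)
      (fun x => le_max_right _ _)
      (fun x hx => (continuousAt_const.add (hg x hx)).max continuousAt_const)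
      (c := ENNReal.ofReal (b * m + ∫ x in D, g x ∂μHE[n] + η')) (by
        rw [e1]
        exact (ENNReal.ofReal_lt_ofReal_iff (by linarith)).2 (by linarith))
    refine ⟨min e r, lt_min he hr, fun B hB hB0 hfin => ?_⟩
    set Z := S ∩ (Metric.infDist · D) ⁻¹' B with hZ
    have hZm : MeasurableSet Z := h.isOpen.measurableSet.inter
      ((Metric.continuous_infDist_pt D).measurable hB)
    have hgZ : ∀ x ∈ Z, |g x| ≤ b := fun x hx =>
      hgb x ((hB0 hx.2).2.trans_le (min_le_right _ _))
    have hgi : IntegrableOn g Z := Measure.integrableOn_of_bounded hfin hgm.aestronglyMeasurable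
      (ae_restrict_of_forall_mem hZm hgZ)
    refine ⟨hgi, ?_⟩
    have h1 := H B hB (hB0.trans (Ioo_subset_Ioo_right (min_le_left _ _)))
    have h2 := lintegral_ofReal_max_add hZm hfin hgi hgZ
    have hBfin : volume B ≠ ⊤ := ((measure_mono hB0).trans_lt (by simp)).ne
    rw [h2, ← ofReal_measureReal hBfin, ← ENNReal.ofReal_mul (by linarith)] at h1
    exact (ENNReal.ofReal_le_ofReal_iff (by
      have : 0 ≤ b * m + ∫ x in D, g x ∂μHE[n] + η' := by linarith
      positivity)).1 h1
  obtain ⟨e1, he1, H1⟩ := upper f hfm hf hbr hfint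
  -- The upper bound for b - f becomes a lower bound for f once the volume is bounded from below.
  obtain ⟨e2, he2, H2⟩ := upper (fun x => -f x) hfm.neg (fun x hx => (hf x hx).neg)
    (fun x hx => by rw [abs_neg]; exact hbr x hx) hfint.neg
  obtain ⟨e3, he3, H3⟩ := h.exists_le_volume_real hη'0
  refine ⟨min e1 (min e2 e3), lt_min he1 (lt_min he2 he3), fun B hB hB0 => ?_⟩
  have hB1 : B ⊆ Ioo 0 e1 := hB0.trans (Ioo_subset_Ioo_right (min_le_left _ _))
  have hB2 : B ⊆ Ioo 0 e2 := hB0.trans (Ioo_subset_Ioo_right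
    ((min_le_right _ _).trans (min_le_left _ _)))
  have hB3 : B ⊆ Ioo 0 e3 := hB0.trans (Ioo_subset_Ioo_right
    ((min_le_right _ _).trans (min_le_right _ _)))
  obtain ⟨hfin, h3⟩ := H3 B hB hB3
  obtain ⟨hint, h1⟩ := H1 B hB hB1 hfin
  obtain ⟨-, h2⟩ := H2 B hB hB2 hfin
  refine ⟨hint, ?_⟩
  rw [integral_neg, integral_neg, ← hI] at h2
  rw [← hI] at h1
  rw [← hm] at h3
  have h4 := mul_le_mul_of_nonneg_left h3 hb0
  have h5 : η * volume.real B = η' * volume.real B + b * η' * volume.real B := by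
    rw [hη']; field_simp
  clear_value m I η'
  generalize ∫ x in S ∩ (Metric.infDist · D) ⁻¹' B, f x = J at h1 h2 ⊢
  generalize volume.real (S ∩ (Metric.infDist · D) ⁻¹' B) = ρ at h1 h2 h3 h4
  generalize volume.real B = V at *
  rw [abs_le]
  constructor <;> linarith

end BoundaryRD

/-! ### Piecewise smooth boundaries have two regular sides -/

namespace BoundaryRD

open scoped ENNReal NNReal

section Patches

variable {n k : ℕ} {K : Fin k → Set (Eucl n)} {φ : Fin k → Eucl n → Eucl (n + 1)}

/-- The sum of the images of Lebesgue measure under the patches. -/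
noncomputable def patchMeasure (K : Fin k → Set (Eucl n)) (φ : Fin k → Eucl n → Eucl (n + 1)) :
    Measure (Eucl (n + 1)) :=
  ∑ j, (volume.restrict (K j)).map (φ j)

theorem patchMeasure_apply (hφ : ∀ j, Continuous (φ j)) {R : Set (Eucl (n + 1))}
    (hR : MeasurableSet R) :
    patchMeasure K φ R = ∑ j, volume (K j ∩ φ j ⁻¹' R) := by
  rw [patchMeasure, Measure.finsetSum_apply]
  refine Finset.sum_congr rfl fun j _ => ?_
  rw [Measure.map_apply (hφ j).measurable hR, Measure.restrict_apply ((hφ j).measurable hR),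
    inter_comm]

theorem isFiniteMeasure_patchMeasure (hφ : ∀ j, Continuous (φ j)) (hK : ∀ j, IsCompact (K j)) :
    IsFiniteMeasure (patchMeasure K φ) := by
  refine ⟨?_⟩
  rw [patchMeasure_apply hφ MeasurableSet.univ]
  refine ENNReal.sum_lt_top.2 fun j _ => ?_
  exact (measure_mono inter_subset_left).trans_lt (hK j).measure_lt_top

/-- A smooth patch need not be globally Lipschitz, as the neighbourhood estimate requires; only its
values on K matter. -/
theorem exists_lipschitz_extension {φ : Eucl n → Eucl (n + 1)} {K : Set (Eucl n)}
    (hφ : ContDiff ℝ ∞ φ) (hK : IsCompact K) :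
    ∃ (g : Eucl n → Eucl (n + 1)) (L : ℝ≥0), LipschitzWith L g ∧ EqOn φ g K := by
  obtain ⟨C, hC⟩ := LocallyLipschitzOn.exists_lipschitzOnWith_of_compact hK
    ((hφ.of_le (by simp)).locallyLipschitz (𝕂 := ℝ)).locallyLipschitzOn
  obtain ⟨g, hg, he⟩ := hC.extend_finite_dimension
  exact ⟨g, _, hg, he⟩

/-- Each subset of D is a union of Lipschitz images of its parameter sets. For each patch, L ^ n
controls Hausdorff measure and `contentConst` controls neighbourhoods; M sums both over the patches.
-/
theorem exists_controlsContent {D : Set (Eucl (n + 1))} (hK : ∀ j, IsCompact (K j))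
    (hφ : ∀ j, ContDiff ℝ ∞ (φ j)) (hD : D = ⋃ j, φ j '' K j) :
    ∃ M, ControlsContent D (patchMeasure K φ) M := by
  choose g L hg hφg using fun j => exists_lipschitz_extension (hφ j) (hK j)
  have himg : ∀ R ⊆ D, R = ⋃ j, g j '' (K j ∩ φ j ⁻¹' R) := by
    intro R hR
    refine Subset.antisymm (fun x hx => ?_) (iUnion_subset fun j => ?_)
    · have := hR hx
      rw [hD] at this
      obtain ⟨j, u, hu, rfl⟩ := mem_iUnion.1 this
      exact mem_iUnion.2 ⟨j, u, ⟨hu, hx⟩, (hφg j hu).symm⟩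
    · rintro _ ⟨u, ⟨hu, huR⟩, rfl⟩
      rw [← hφg j hu]
      exact huR
  have hle : ∀ {R : Set (Eucl (n + 1))}, MeasurableSet R → ∀ a : Fin k → ℝ≥0∞,
      (∀ j, a j ≤ (L j : ℝ≥0∞) ^ n + contentConst n (L j)) →
      ∑ j, a j * volume (K j ∩ φ j ⁻¹' R) ≤
        (∑ j, ((L j : ℝ≥0∞) ^ n + contentConst n (L j))) * patchMeasure K φ R := by
    intro R hR a ha
    rw [patchMeasure_apply (fun j => (hφ j).continuous) hR, Finset.mul_sum]
    refine Finset.sum_le_sum fun j _ => ?_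
    gcongr
    exact (ha j).trans (Finset.single_le_sum
      (f := fun j => (L j : ℝ≥0∞) ^ n + contentConst n (L j)) (fun _ _ => zero_le)
      (Finset.mem_univ j))
  refine ⟨∑ j, ((L j : ℝ≥0∞) ^ n + contentConst n (L j)), ?_, ?_, ?_⟩
  · refine ENNReal.sum_ne_top.2 fun j _ => ENNReal.add_ne_top.2
      ⟨ENNReal.pow_ne_top ENNReal.coe_ne_top, contentConst_ne_top _ _⟩
  · intro R hRD hR
    refine le_trans ?_ (hle hR (fun j => (L j : ℝ≥0∞) ^ n) fun j => le_self_add)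
    conv_lhs => rw [himg R hRD]
    refine (measure_iUnion_le _).trans ?_
    rw [tsum_fintype]
    refine Finset.sum_le_sum fun j _ => ?_
    have := euclideanHausdorffMeasure_image_le ((hg j).lipschitzOnWith
      (s := K j ∩ φ j ⁻¹' R)) n
    rwa [EuclideanSpace.euclideanHausdorffMeasure_eq_volume] at this
  · intro R hRD hR c hc
    have hAc : ∀ j, IsCompact (K j ∩ φ j ⁻¹' R) := fun j =>
      (hK j).inter_right (hR.isClosed.preimage (hφ j).continuous)
    obtain ⟨τ, hτ, hτsum⟩ := ENNReal.exists_pos_sum_of_countable' (tsub_pos_of_lt hc).ne' (Fin k)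
    rw [tsum_fintype] at hτsum
    have hev : ∀ᶠ ε in 𝓝[>] (0 : ℝ), ∀ j,
        volume (Metric.cthickening ε (g j '' (K j ∩ φ j ⁻¹' R))) ≤
          (contentConst n (L j) * volume (K j ∩ φ j ⁻¹' R) + τ j) * ENNReal.ofReal ε := by
      refine eventually_all.2 fun j => ?_
      refine eventually_volume_cthickening_image_le (hg j) (hAc j) ?_
      refine ENNReal.lt_add_right (ENNReal.mul_ne_top (contentConst_ne_top _ _) ?_) (hτ j).ne'
      exact (hAc j).measure_lt_top.ne
    filter_upwards [hev, self_mem_nhdsWithin] with ε h1 hε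
    have hε : 0 < ε := hε
    have hsub : Metric.cthickening ε R ⊆
        ⋃ j, Metric.cthickening ε (g j '' (K j ∩ φ j ⁻¹' R)) := by
      intro x hx
      obtain ⟨y, hy, hxy⟩ := exists_dist_le_of_mem_cthickening hR hε.le hx
      rw [himg R hRD] at hy
      obtain ⟨j, hj⟩ := mem_iUnion.1 hy
      exact mem_iUnion.2 ⟨j, Metric.mem_cthickening_of_dist_le _ _ _ _ hj hxy⟩
    calc volume (Metric.cthickening ε R)
        ≤ ∑ j, volume (Metric.cthickening ε (g j '' (K j ∩ φ j ⁻¹' R))) :=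
          (measure_mono hsub).trans ((measure_iUnion_le _).trans_eq (tsum_fintype _))
      _ ≤ ∑ j, (contentConst n (L j) * volume (K j ∩ φ j ⁻¹' R) + τ j) * ENNReal.ofReal ε :=
          Finset.sum_le_sum fun j _ => h1 j
      _ = (∑ j, contentConst n (L j) * volume (K j ∩ φ j ⁻¹' R) + ∑ j, τ j) *
            ENNReal.ofReal ε := by
          rw [← Finset.sum_mul, Finset.sum_add_distrib]
      _ ≤ c * ENNReal.ofReal ε := by
          gcongr
          refine (add_le_add (hle hR.isClosed.measurableSet (fun j => contentConst n (L j))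
            fun j => le_add_self) hτsum.le).trans_eq ?_
          exact add_tsub_cancel_of_le hc.le

/-- The rest of the boundary, parametrized by everything but the neighbourhood of u in patch j, is
compact and misses φ j u by injectivity, hence stays away from it. -/
theorem eventually_mem_patch {D : Set (Eucl (n + 1))} (hK : ∀ j, IsCompact (K j))
    (hφ : ∀ j, ContDiff ℝ ∞ (φ j)) (hD : D = ⋃ j, φ j '' K j)
    (hinj : ∀ i j, ∀ u ∈ interior (K i), ∀ v ∈ K j, φ i u = φ j v → i = j ∧ u = v)
    {j : Fin k} {u : Eucl n} (hu : u ∈ interior (K j)) {N : Set (Eucl n)} (hN : N ∈ 𝓝 u) :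
    ∀ᶠ x in 𝓝 (φ j u), x ∈ D → ∃ v ∈ N, x = φ j v := by
  obtain ⟨N', hN'N, hN'o, huN'⟩ := mem_nhds_iff.1 hN
  set T : Set (Eucl (n + 1)) := ⋃ i, φ i '' {v | v ∈ K i ∧ ¬ (i = j ∧ v ∈ N')} with hT
  have hTc : IsCompact T := by
    refine isCompact_iUnion fun i => IsCompact.image ?_ (hφ i).continuous
    by_cases hij : i = j
    · have : {v | v ∈ K i ∧ ¬ (i = j ∧ v ∈ N')} = K i \ N' := by
        ext v; simp [hij]
      rw [this]
      exact (hK i).diff hN'o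
    · have : {v | v ∈ K i ∧ ¬ (i = j ∧ v ∈ N')} = K i := by
        ext v; simp [hij]
      rw [this]
      exact hK i
  have huT : φ j u ∉ T := by
    intro h
    obtain ⟨i, v, ⟨hv, hcon⟩, he⟩ := mem_iUnion.1 h
    obtain ⟨rfl, rfl⟩ := hinj j i u hu v hv he.symm
    exact hcon ⟨rfl, huN'⟩
  filter_upwards [hTc.isClosed.isOpen_compl.mem_nhds huT] with x hxT hxD
  rw [hD] at hxD
  obtain ⟨i, v, hv, rfl⟩ := mem_iUnion.1 hxD
  by_cases hc : i = j ∧ v ∈ N'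
  · obtain ⟨rfl, hvN⟩ := hc
    exact ⟨v, hN'N hvN, rfl⟩
  · exact (hxT (mem_iUnion.2 ⟨i, v, ⟨hv, hc⟩, rfl⟩)).elim

/-- Frontiers of the parameter sets are null, so inner regularity applied to their interiors
exhausts the patch measure by compact sets of regular points. -/
theorem exists_regular_compact {D : Set (Eucl (n + 1))} (hK : ∀ j, IsCompact (K j))
    (hK0 : ∀ j, volume (frontier (K j)) = 0)
    (hφ : ∀ j, ContDiff ℝ ∞ (φ j)) (hD : D = ⋃ j, φ j '' K j) {η : ℝ≥0∞} (hη : 0 < η) :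
    ∃ Q ⊆ D, IsCompact Q ∧ patchMeasure K φ (D \ Q) < η ∧
      ∀ p ∈ Q, ∃ j, ∃ u ∈ interior (K j), p = φ j u := by
  obtain ⟨τ, hτ, hτsum⟩ := ENNReal.exists_pos_sum_of_countable' hη.ne' (Fin k)
  rw [tsum_fintype] at hτsum
  have hint : ∀ j, volume (interior (K j)) ≠ ⊤ := fun j =>
    ((measure_mono interior_subset).trans_lt (hK j).measure_lt_top).ne
  choose A hAK hAc hAτ using fun j =>
    (isOpen_interior (s := K j)).measurableSet.exists_isCompact_sdiff_lt (hint j) (hτ j).ne'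
  have hDc : IsCompact D := hD ▸ isCompact_iUnion fun j => (hK j).image (hφ j).continuous
  have hQc : IsCompact (⋃ j, φ j '' A j) :=
    isCompact_iUnion fun j => (hAc j).image (hφ j).continuous
  refine ⟨⋃ j, φ j '' A j, ?_, hQc, ?_, ?_⟩
  · rw [hD]
    exact iUnion_mono fun j => image_mono ((hAK j).trans interior_subset)
  · rw [patchMeasure_apply (fun j => (hφ j).continuous)
      (hDc.isClosed.measurableSet.diff hQc.isClosed.measurableSet)]
    refine lt_of_le_of_lt (Finset.sum_le_sum fun j _ => ?_) hτsum
    have hsub : K j ∩ φ j ⁻¹' (D \ ⋃ j, φ j '' A j) ⊆ (interior (K j) \ A j) ∪ frontier (K j) := by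
      rintro u ⟨hu, -, huQ⟩
      by_cases hui : u ∈ interior (K j)
      · exact Or.inl ⟨hui, fun huA => huQ (mem_iUnion.2 ⟨j, u, huA, rfl⟩)⟩
      · exact Or.inr ⟨subset_closure hu, hui⟩
    refine (measure_mono hsub).trans ((measure_union_le _ _).trans ?_)
    rw [hK0 j, add_zero]
    exact (hAτ j).le
  · intro p hp
    obtain ⟨j, u, hu, rfl⟩ := mem_iUnion.1 hp
    exact ⟨j, u, hAK j hu, rfl⟩

end Patches

/-- The interior of Ω and its complement are the two sides. The interior accumulates at every
boundary point because Ω is the closure of its interior; this excludes slits with the same set on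
both sides. -/
theorem exists_isSide {n : ℕ} {Ω : Set (Eucl (n + 1))} (hcl : IsClosed Ω)
    (hbdd : Bornology.IsBounded Ω) (hΩ : HasPiecewiseSmoothBoundary Ω)
    (hne : (frontier Ω).Nonempty) :
    ∃ (κ : Measure (Eucl (n + 1))) (M : ℝ≥0∞), IsFiniteMeasure κ ∧
      IsSide (frontier Ω) (interior Ω) κ M ∧ IsSide (frontier Ω) Ωᶜ κ M := by
  obtain ⟨hreg, k, K, φ, hK, hK0, hφ, himm, hinj, hfr⟩ := hΩ
  have hDc : IsCompact (frontier Ω) :=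
    Metric.isCompact_of_isClosed_isBounded isClosed_frontier (hbdd.subset hcl.frontier_subset)
  obtain ⟨M, hM⟩ := exists_controlsContent hK hφ hfr
  have hfin := isFiniteMeasure_patchMeasure (K := K) (fun j => (hφ j).continuous) hK
  have hd₁ : Disjoint (interior Ω) (frontier Ω) := disjoint_interior_frontier
  have hd₂ : Disjoint Ωᶜ (frontier Ω) :=
    disjoint_compl_left.mono_right hcl.frontier_subset
  have hf₂ : frontier Ωᶜ ⊆ frontier Ω := (frontier_compl Ω).subset
  have hboth : ∀ η : ℝ≥0∞, 0 < η → ∃ Q ⊆ frontier Ω, IsCompact Q ∧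
      patchMeasure K φ (frontier Ω \ Q) < η ∧ ∀ p ∈ Q, ∀ δ : ℝ≥0, 0 < δ →
        IsLocalGraph (frontier Ω) (interior Ω) δ p ∧ IsLocalGraph (frontier Ω) Ωᶜ δ p := by
    intro η hη
    obtain ⟨Q, hQD, hQ, hQη, hQreg⟩ := exists_regular_compact hK hK0 hφ hfr hη
    refine ⟨Q, hQD, hQ, hQη, fun p hp δ hδ => ?_⟩
    have hpD := hQD hp
    obtain ⟨j, u, hu, rfl⟩ := hQreg p hp
    have h2 : ∀ᶠ v in 𝓝 u, φ j v ∈ frontier Ω := by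
      filter_upwards [isOpen_interior.mem_nhds hu] with v hv
      rw [hfr]
      exact mem_iUnion.2 ⟨j, v, interior_subset hv, rfl⟩
    refine isLocalGraph_of_immersion (hφ j) (himm j u hu)
      (fun N hN => eventually_mem_patch hK hφ hfr hinj hu hN) h2 hδ isOpen_interior
      hcl.isOpen_compl frontier_interior_subset hf₂ hd₁ hd₂
      (disjoint_compl_right.mono_left interior_subset) ?_ ?_
    · rw [hreg]
      exact hcl.frontier_subset hpD
    · rw [frontier_eq_closure_inter_closure] at hpD
      exact hpD.2
  refine ⟨patchMeasure K φ, M, hfin, ⟨hDc, hne, isOpen_interior, hd₁, frontier_interior_subset, hM,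
    fun η hη => ?_⟩, ⟨hDc, hne, hcl.isOpen_compl, hd₂, hf₂, hM, fun η hη => ?_⟩⟩
  · obtain ⟨Q, h1, h2, h3, h4⟩ := hboth η hη
    exact ⟨Q, h1, h2, h3, fun p hp δ hδ => (h4 p hp δ hδ).1⟩
  · obtain ⟨Q, h1, h2, h3, h4⟩ := hboth η hη
    exact ⟨Q, h1, h2, h3, fun p hp δ hδ => (h4 p hp δ hδ).2⟩

end BoundaryRD

/-! ### Essential limits at zero -/

namespace BoundaryRD

/-- Up to null sets, one-sided neighbourhoods of `0` are nontrivial. -/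
instance neBot_nhdsGT_inf_ae : NeBot (𝓝[>] (0 : ℝ) ⊓ ae volume) := by
  refine Filter.inf_neBot_iff.2 fun {s} hs {t} ht => ?_
  obtain ⟨u, hu, hus⟩ := mem_nhdsGT_iff_exists_Ioo_subset.1 hs
  by_contra hne
  have hsub : Ioo 0 u ⊆ tᶜ := fun x hx hxt => hne ⟨x, hus hx, hxt⟩
  have h0 : volume (Ioo 0 u) = 0 := measure_mono_null hsub ht
  rw [Real.volume_Ioo, ENNReal.ofReal_eq_zero] at h0
  have : (0 : ℝ) < u := hu
  linarith

theorem HasEssLimitAtZero.Iio_of_comp_neg {k : ℝ → ℝ} {L : ℝ}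
    (h : HasEssLimitAtZero (fun r => k (-r)) (Ioi 0) L) : HasEssLimitAtZero k (Iio 0) L := by
  unfold HasEssLimitAtZero at h ⊢
  have h1 : Tendsto (fun r : ℝ => -r) (𝓝[<] 0 ⊓ ae volume) (𝓝[>] 0 ⊓ ae volume) := by
    refine Filter.Tendsto.inf ?_ ?_
    · have := tendsto_neg_nhdsLT (a := (0 : ℝ))
      rwa [neg_zero] at this
    · exact (Measure.measurePreserving_neg (volume : Measure ℝ)).quasiMeasurePreserving.tendsto_ae
  have h2 := h.comp h1
  simpa [Function.comp_def] using h2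

theorem HasEssLimitAtZero.univ_of_one_sided {k : ℝ → ℝ} {L : ℝ}
    (hp : HasEssLimitAtZero k (Ioi 0) L) (hm : HasEssLimitAtZero k (Iio 0) L) :
    HasEssLimitAtZero k univ L := by
  unfold HasEssLimitAtZero at hp hm ⊢
  refine (hm.sup hp).mono_left ?_
  -- The two sides miss only the point 0, which is null.
  rw [← inf_sup_right, nhdsLT_sup_nhdsGT, nhdsWithin_univ, nhdsWithin, inf_assoc]
  refine le_inf inf_le_left (le_inf (inf_le_right.trans ?_) inf_le_right)
  rw [le_principal_iff]
  exact Measure.ae_ne volume (0 : ℝ)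

/-- A function whose integrals match those of `f` over the preimages of the distance to `D` has, at
`0`, the surface integral of `f` as its essential limit. -/
theorem IsSide.hasEssLimitAtZero {n : ℕ} {D S : Set (Eucl (n + 1))} {κ : Measure (Eucl (n + 1))}
    {M : ENNReal} [IsFiniteMeasure κ] (h : IsSide D S κ M) {f : Eucl (n + 1) → ℝ} (hfm : Measurable f)
    (hf : ∀ x ∈ D, ContinuousAt f x) {k : ℝ → ℝ} (hk : Integrable k)
    (hkf : ∀ B, MeasurableSet B → B ⊆ Ioi 0 →
      ∫ r in B, k r = ∫ x in S ∩ (Metric.infDist · D) ⁻¹' B, f x) :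
    HasEssLimitAtZero k (Ioi 0) (∫ x in D, f x ∂μHE[n]) := by
  unfold HasEssLimitAtZero
  set I := ∫ x in D, f x ∂μHE[n] with hI
  rw [Metric.tendsto_nhds]
  intro η hη
  obtain ⟨ε, hε, happ⟩ := h.exists_integral_approx hfm hf (half_pos hη)
  have key : ∀ B, MeasurableSet B →
      |(∫ r in B ∩ Ioo 0 ε, k r) - I * volume.real (B ∩ Ioo 0 ε)| ≤
        η / 2 * volume.real (B ∩ Ioo 0 ε) := by
    intro B hB
    have hm := hB.inter (measurableSet_Ioo (a := (0 : ℝ)) (b := ε))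
    rw [hkf _ hm (inter_subset_right.trans Ioo_subset_Ioi_self)]
    exact (happ _ hm inter_subset_right).2
  have hc : ∀ (c : ℝ) (B : Set ℝ), MeasurableSet B →
      ∫ _ in B, c ∂(volume.restrict (Ioo 0 ε)) = volume.real (B ∩ Ioo 0 ε) * c := by
    intro c B hB
    rw [Measure.restrict_restrict hB, setIntegral_const, smul_eq_mul]
  -- The estimate holds on every Borel subset of (0, ε), not only on intervals with a shrinking end;
  -- this is what turns it into an inequality for almost every r.
  have hle : ∀ᵐ r ∂(volume.restrict (Ioo 0 ε)), k r ≤ I + η / 2 := by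
    refine ae_le_of_forall_setIntegral_le hk.integrableOn (integrable_const _) fun B hB _ => ?_
    rw [hc _ _ hB, Measure.restrict_restrict hB]
    linarith [(abs_le.1 (key B hB)).2]
  have hge : ∀ᵐ r ∂(volume.restrict (Ioo 0 ε)), I - η / 2 ≤ k r := by
    refine ae_le_of_forall_setIntegral_le (integrable_const _) hk.integrableOn fun B hB _ => ?_
    rw [hc _ _ hB, Measure.restrict_restrict hB]
    linarith [(abs_le.1 (key B hB)).1]
  rw [ae_restrict_iff' measurableSet_Ioo] at hle hge
  refine Filter.mem_inf_of_inter (Ioo_mem_nhdsGT hε) (hle.and hge) ?_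
  rintro r ⟨hr, h1, h2⟩
  have a1 := h1 hr
  have a2 := h2 hr
  change dist (k r) I < η
  rw [Real.dist_eq, abs_lt]
  constructor <;> linarith

/-! ### Regression functions, densities and the support of the law -/

section Density

variable {S Z : Type*} [MeasurableSpace S] [MeasureSpace Z] {P : Measure S}
  {W : S → ℝ} {V : S → Z} {m f : Z → ℝ}

theorem IsRegressionFunction.integrable_mul_density (hm : IsRegressionFunction P W V m)
    (hV : Measurable V) (hf : IsDensity P V f) : Integrable fun z => m z * f z := by
  have h1 : Integrable (fun s => m (V s)) P := integrable_condExp.congr hm.2.symm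
  have h2 : Integrable m (P.map V) :=
    (integrable_map_measure hm.1.aestronglyMeasurable hV.aemeasurable).2 h1
  rw [hf.2.2, integrable_withDensity_iff_integrable_smul' hf.1.ennreal_ofReal
    (Eventually.of_forall fun _ => ENNReal.ofReal_lt_top)] at h2
  refine h2.congr (Eventually.of_forall fun z => ?_)
  simp [ENNReal.toReal_ofReal (hf.2.1 z), mul_comm]

theorem IsRegressionFunction.setIntegral_preimage [IsFiniteMeasure P]
    (hm : IsRegressionFunction P W V m)
    (hV : Measurable V) (hW : Integrable W P) (hf : IsDensity P V f) {B : Set Z}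
    (hB : MeasurableSet B) : ∫ s in V ⁻¹' B, W s ∂P = ∫ z in B, m z * f z := by
  rw [← setIntegral_condExp hV.comap_le hW ⟨B, hB, rfl⟩,
    ← setIntegral_congr_ae (hV hB) (hm.2.mono fun _ hx _ => hx),
    ← setIntegral_map hB hm.1.aestronglyMeasurable hV.aemeasurable, hf.2.2,
    setIntegral_withDensity_eq_setIntegral_toReal_smul₀ hf.1.ennreal_ofReal.aemeasurable
      (Eventually.of_forall fun _ => ENNReal.ofReal_lt_top) _ hB]
  refine integral_congr_ae (Eventually.of_forall fun z => ?_)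
  simp [ENNReal.toReal_ofReal (hf.2.1 z), mul_comm]

theorem isRegressionFunction_one [IsFiniteMeasure P] (hV : Measurable V) :
    IsRegressionFunction P (fun _ => 1) V fun _ => 1 :=
  ⟨measurable_const, by rw [condExp_const hV.comap_le]⟩

theorem IsDensity.ae_of_ae_comp (hV : Measurable V) (hf : IsDensity P V f) {p : Z → Prop}
    (hp : MeasurableSet {z | p z}) (h : ∀ᵐ s ∂P, p (V s)) : ∀ᵐ z, f z ≠ 0 → p z := by
  have h1 : ∀ᵐ z ∂(P.map V), p z := (ae_map_iff hV.aemeasurable hp).2 h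
  rw [hf.2.2, ae_withDensity_iff hf.1.ennreal_ofReal] at h1
  filter_upwards [h1] with z hz h0
  refine hz ?_
  rw [Ne, ENNReal.ofReal_eq_zero, not_le]
  exact lt_of_le_of_ne (hf.2.1 z) (Ne.symm h0)

end Density

section Support

variable {S Z : Type*} [MeasurableSpace S] [MeasureSpace Z] [TopologicalSpace Z]
  {P : Measure S} {V : S → Z} {m f : Z → ℝ}

theorem IsDensity.support_mem_nhds [BorelSpace Z] [(volume : Measure Z).IsOpenPosMeasure]
    (hf : IsDensity P V f) {p : Z} (hp : ContinuousAt f p) (hpos : f p ≠ 0) :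
    (P.map V).support ∈ 𝓝 p := by
  have h0 : ∀ᶠ z in 𝓝 p, f z ≠ 0 := hp.eventually_ne hpos
  filter_upwards [eventually_eventually_nhds.2 h0] with z hz
  rw [Measure.mem_support_iff_forall]
  intro U hU
  obtain ⟨O, hO, hOo, hzO⟩ := mem_nhds_iff.1 (inter_mem hU hz)
  refine lt_of_lt_of_le ?_ (measure_mono (hO.trans inter_subset_left))
  rw [hf.2.2, withDensity_apply _ hOo.measurableSet, setLIntegral_pos_iff hf.1.ennreal_ofReal]
  refine lt_of_lt_of_le (hOo.measure_pos volume ⟨z, hzO⟩) (measure_mono fun y hy => ⟨?_, hy⟩)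
  rw [Function.mem_support, Ne, ENNReal.ofReal_eq_zero, not_le]
  exact lt_of_le_of_ne (hf.2.1 y) (Ne.symm (hO hy).2)

/-- Where f vanishes, boundedness of m forces the product to 0 even if the cut-off jumps. Where it
does not, the support is a neighbourhood of p and the cut-off is invisible. -/
theorem IsDensity.continuousAt_indicator_support_mul [BorelSpace Z]
    [(volume : Measure Z).IsOpenPosMeasure] (hf : IsDensity P V f) {p : Z}
    (hp : ContinuousAt f p) (hm : ContinuousOn m (P.map V).support) {C : ℝ}
    (hC : ∀ z ∈ (P.map V).support, |m z| ≤ C) :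
    ContinuousAt (fun z => (P.map V).support.indicator m z * f z) p := by
  by_cases h0 : f p = 0
  · have hb : ∀ z, |(P.map V).support.indicator m z * f z| ≤ |C| * |f z| := by
      intro z
      rw [abs_mul]
      refine mul_le_mul_of_nonneg_right ?_ (abs_nonneg _)
      by_cases hz : z ∈ (P.map V).support
      · rw [indicator_of_mem hz]
        exact (hC z hz).trans (le_abs_self C)
      · rw [indicator_of_notMem hz, abs_zero]
        exact abs_nonneg C
    rw [ContinuousAt, h0, mul_zero]
    refine squeeze_zero_norm hb ?_
    have : Tendsto (fun z => |C| * |f z|) (𝓝 p) (𝓝 (|C| * |f p|)) := (hp.abs).const_mul _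
    simpa [h0] using this
  · have hs := hf.support_mem_nhds hp h0
    refine ((hm.continuousAt hs).mul hp).congr ?_
    filter_upwards [hs] with z hz
    rw [indicator_of_mem hz, Pi.mul_apply]

theorem IsDensity.indicator_support_mul_ae_eq [HereditarilyLindelofSpace Z] [BorelSpace Z]
    (hf : IsDensity P V f) :
    (fun z => (P.map V).support.indicator m z * f z) =ᵐ[volume] fun z => m z * f z := by
  have h1 : ∀ᵐ z ∂(P.map V), z ∈ (P.map V).support := Measure.support_mem_ae
  rw [hf.2.2, ae_withDensity_iff hf.1.ennreal_ofReal, ← hf.2.2] at h1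
  filter_upwards [h1] with z hz
  by_cases h0 : f z = 0
  · simp [h0]
  · rw [indicator_of_mem (hz ?_)]
    rw [Ne, ENNReal.ofReal_eq_zero, not_le]
    exact lt_of_le_of_ne (hf.2.1 z) (Ne.symm h0)

end Support

end BoundaryRD

/-! ### Regression on the signed distance -/

namespace BoundaryRD

section SignedDistance

variable {n : ℕ} {Ω : Set (Eucl (n + 1))}

theorem measurable_signedDistance (hΩ : MeasurableSet Ω) : Measurable (signedDistance Ω) :=
  (Metric.continuous_infDist_pt _).measurable.ite hΩ
    (Metric.continuous_infDist_pt _).measurable.neg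

theorem signedDistance_preimage_of_subset_Ioi {B : Set ℝ} (hB : B ⊆ Ioi 0) :
    signedDistance Ω ⁻¹' B = interior Ω ∩ (Metric.infDist · (frontier Ω)) ⁻¹' B := by
  ext x
  simp only [mem_preimage, mem_inter_iff, signedDistance]
  constructor
  · intro hx
    by_cases h : x ∈ Ω
    · rw [if_pos h] at hx
      refine ⟨by_contra fun hi => ?_, hx⟩
      have h0 : Metric.infDist x (frontier Ω) = 0 :=
        Metric.infDist_zero_of_mem ⟨subset_closure h, hi⟩
      exact absurd (hB hx) (by simp [h0])
    · rw [if_neg h] at hx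
      have h1 : 0 < -Metric.infDist x (frontier Ω) := hB hx
      linarith [Metric.infDist_nonneg (x := x) (s := frontier Ω)]
  · rintro ⟨h, hx⟩
    rwa [if_pos (interior_subset h)]

theorem neg_signedDistance_preimage_of_subset_Ioi {B : Set ℝ} (hB : B ⊆ Ioi 0) :
    (fun x => -signedDistance Ω x) ⁻¹' B = Ωᶜ ∩ (Metric.infDist · (frontier Ω)) ⁻¹' B := by
  ext x
  simp only [mem_preimage, mem_inter_iff, signedDistance]
  constructor
  · intro hx
    by_cases h : x ∈ Ω
    · rw [if_pos h] at hx
      have h1 : 0 < -Metric.infDist x (frontier Ω) := hB hx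
      linarith [Metric.infDist_nonneg (x := x) (s := frontier Ω)]
    · rw [if_neg h, neg_neg] at hx
      exact ⟨h, hx⟩
  · rintro ⟨h, hx⟩
    rwa [if_neg h, neg_neg]

/-- `Metric.infDist` to the empty set is 0 by convention, so an empty boundary would give the signed
distance an atom at 0, which a density excludes. -/
theorem frontier_nonempty_of_isDensity {S : Type*} [MeasurableSpace S] {P : Measure S}
    [IsProbabilityMeasure P] {X : S → Eucl (n + 1)} {fg : ℝ → ℝ} (hΩ : MeasurableSet Ω)
    (hX : Measurable X) (hfg : IsDensity P (fun s => signedDistance Ω (X s)) fg) :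
    (frontier Ω).Nonempty := by
  by_contra hne
  rw [not_nonempty_iff_eq_empty] at hne
  have h0 : ∀ x, signedDistance Ω x = 0 := by
    intro x
    simp [signedDistance, hne, Metric.infDist_empty]
  have h1 := congrArg (fun μ => μ {(0 : ℝ)}) hfg.2.2
  have hg : Measurable fun s => signedDistance Ω (X s) := (measurable_signedDistance hΩ).comp hX
  rw [Measure.map_apply hg (measurableSet_singleton _),
    withDensity_absolutelyContinuous _ _ (measure_singleton (0 : ℝ))] at h1
  have h2 : (fun s => signedDistance Ω (X s)) ⁻¹' {0} = univ := by
    ext s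
    simp [h0]
  rw [h2, measure_univ] at h1
  exact one_ne_zero h1

/-- The density-weighted regression functions of a variable `W` on a vector `X` and on its signed
distance `g` to the boundary: the essential limits at `0±` of the latter are the surface integrals of
the former, whenever the two variables regressed agree on the corresponding side. -/
theorem hasEssLimitAtZero_Ioi_of_regression {S : Type*} [MeasurableSpace S] {P : Measure S}
    [IsProbabilityMeasure P] {X : S → Eucl (n + 1)} (hX : Measurable X) (hΩ : MeasurableSet Ω)
    {κ : Measure (Eucl (n + 1))} [IsFiniteMeasure κ] {M : ENNReal}
    (hside : IsSide (frontier Ω) (interior Ω) κ M)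
    {U W : S → ℝ} (hU : Integrable U P) (hW : Integrable W P) (hUW : ∀ s, X s ∈ Ω → U s = W s)
    {fX : Eucl (n + 1) → ℝ} (hfX : IsDensity P X fX)
    {fg : ℝ → ℝ} (hfg : IsDensity P (fun s => signedDistance Ω (X s)) fg)
    {m : Eucl (n + 1) → ℝ} (hm : IsRegressionFunction P W X m)
    {h : ℝ → ℝ} (hh : IsRegressionFunction P U (fun s => signedDistance Ω (X s)) h)
    {ψ : Eucl (n + 1) → ℝ} (hψm : Measurable ψ) (hψ : ∀ x ∈ frontier Ω, ContinuousAt ψ x)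
    (hψae : ψ =ᵐ[volume] fun x => m x * fX x) :
    HasEssLimitAtZero (fun r => h r * fg r) (Ioi 0) (∫ x in frontier Ω, ψ x ∂μHE[n]) := by
  have hg : Measurable fun s => signedDistance Ω (X s) := (measurable_signedDistance hΩ).comp hX
  refine hside.hasEssLimitAtZero hψm hψ (hh.integrable_mul_density hg hfg) fun B hB hB0 => ?_
  have hA : MeasurableSet (signedDistance Ω ⁻¹' B) := measurable_signedDistance hΩ hB
  have hpre : signedDistance Ω ⁻¹' B = _ := signedDistance_preimage_of_subset_Ioi hB0
  rw [← hpre, integral_congr_ae (ae_restrict_of_ae hψae), ← hh.setIntegral_preimage hg hU hfg hB,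
    ← hm.setIntegral_preimage hX hW hfX hA]
  refine setIntegral_congr_fun (hg hB) fun s hs => hUW s ?_
  have hs' : X s ∈ signedDistance Ω ⁻¹' B := hs
  rw [hpre] at hs'
  exact interior_subset hs'.1

theorem hasEssLimitAtZero_Iio_of_regression {S : Type*} [MeasurableSpace S] {P : Measure S}
    [IsProbabilityMeasure P] {X : S → Eucl (n + 1)} (hX : Measurable X) (hΩ : MeasurableSet Ω)
    {κ : Measure (Eucl (n + 1))} [IsFiniteMeasure κ] {M : ENNReal}
    (hside : IsSide (frontier Ω) Ωᶜ κ M)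
    {U W : S → ℝ} (hU : Integrable U P) (hW : Integrable W P) (hUW : ∀ s, X s ∉ Ω → U s = W s)
    {fX : Eucl (n + 1) → ℝ} (hfX : IsDensity P X fX)
    {fg : ℝ → ℝ} (hfg : IsDensity P (fun s => signedDistance Ω (X s)) fg)
    {m : Eucl (n + 1) → ℝ} (hm : IsRegressionFunction P W X m)
    {h : ℝ → ℝ} (hh : IsRegressionFunction P U (fun s => signedDistance Ω (X s)) h)
    {ψ : Eucl (n + 1) → ℝ} (hψm : Measurable ψ) (hψ : ∀ x ∈ frontier Ω, ContinuousAt ψ x)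
    (hψae : ψ =ᵐ[volume] fun x => m x * fX x) :
    HasEssLimitAtZero (fun r => h r * fg r) (Iio 0) (∫ x in frontier Ω, ψ x ∂μHE[n]) := by
  have hg : Measurable fun s => signedDistance Ω (X s) := (measurable_signedDistance hΩ).comp hX
  refine HasEssLimitAtZero.Iio_of_comp_neg ?_
  refine hside.hasEssLimitAtZero hψm hψ (hh.integrable_mul_density hg hfg).comp_neg
    fun B hB hB0 => ?_
  have hA : MeasurableSet ((fun x => -signedDistance Ω x) ⁻¹' B) :=
    (measurable_signedDistance hΩ).neg hB
  have hpre : (fun x => -signedDistance Ω x) ⁻¹' B = _ :=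
    neg_signedDistance_preimage_of_subset_Ioi hB0
  have hB' : MeasurableSet (Neg.neg ⁻¹' B) := measurable_neg hB
  have hneg : ∫ r in B, h (-r) * fg (-r) = ∫ r in Neg.neg ⁻¹' B, h r * fg r := by
    rw [← (Measure.measurePreserving_neg (volume : Measure ℝ)).setIntegral_preimage_emb
      (Homeomorph.neg ℝ).measurableEmbedding]
    simp
  rw [← hpre, integral_congr_ae (ae_restrict_of_ae hψae), hneg,
    ← hh.setIntegral_preimage hg hU hfg hB', ← hm.setIntegral_preimage hX hW hfX hA]
  refine setIntegral_congr_fun (hg hB') fun s hs => hUW s ?_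
  have hs' : X s ∈ (fun x => -signedDistance Ω x) ⁻¹' B := hs
  rw [hpre] at hs'
  exact hs'.1

end SignedDistance

theorem integrable_observedOutcome {S E : Type*} [MeasurableSpace S] [MeasurableSpace E]
    {P : Measure S} {Ω : Set E} (hΩ : MeasurableSet Ω) {X : S → E} (hX : Measurable X)
    {Y : Fin 2 → S → ℝ} (hY : ∀ t, Integrable (Y t) P) :
    Integrable (observedOutcome Ω X Y) P := by
  classical
  have h : observedOutcome Ω X Y =
      (X ⁻¹' Ω).indicator (Y 1) + (X ⁻¹' Ω)ᶜ.indicator (Y 0) := by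
    ext s
    by_cases hs : X s ∈ Ω <;> simp [observedOutcome, hs]
  rw [h]
  exact ((hY 1).indicator (hX hΩ)).add ((hY 0).indicator (hX hΩ).compl)

/-- A regression function of a difference agrees with the difference of the regression functions
wherever the density is continuous and positive, if all of them are continuous on the support. -/
theorem IsRegressionFunction.sub_eq_of_density_ne_zero {S Z : Type*} [MeasurableSpace S]
    [MeasureSpace Z] [TopologicalSpace Z] [BorelSpace Z] [(volume : Measure Z).IsOpenPosMeasure]
    {P : Measure S} {V : S → Z} {f : Z → ℝ} {U W : S → ℝ} {m₁ m₂ τ : Z → ℝ}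
    (hV : Measurable V) (hU : Integrable U P) (hW : Integrable W P) (hf : IsDensity P V f)
    (h₁ : IsRegressionFunction P U V m₁) (h₂ : IsRegressionFunction P W V m₂)
    (hτ : IsRegressionFunction P (fun s => U s - W s) V τ)
    (c₁ : ContinuousOn m₁ (P.map V).support) (c₂ : ContinuousOn m₂ (P.map V).support)
    (cτ : ContinuousOn τ (P.map V).support) {p : Z} (hp : ContinuousAt f p) (h0 : f p ≠ 0) :
    τ p = m₁ p - m₂ p := by
  have hs : ∀ᵐ s ∂P, τ (V s) = m₁ (V s) - m₂ (V s) := by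
    filter_upwards [h₁.2, h₂.2, hτ.2,
      condExp_sub hU hW (MeasurableSpace.comap V inferInstance)] with s e1 e2 e3 e4
    rw [e1, e2, e3]
    exact e4
  have hz : ∀ᵐ z, f z ≠ 0 → τ z = m₁ z - m₂ z :=
    hf.ae_of_ae_comp hV (p := fun z => τ z = m₁ z - m₂ z)
      (measurableSet_eq_fun hτ.1 (h₁.1.sub h₂.1)) hs
  -- On an open set around p inside the support the density is nonzero, so the identity holds almost
  -- everywhere there; continuity extends it to p itself.
  obtain ⟨O, hO, hOo, hpO⟩ := mem_nhds_iff.1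
    (inter_mem (hf.support_mem_nhds hp h0) (hp.eventually_ne h0))
  have hae : τ =ᵐ[volume.restrict O] fun z => m₁ z - m₂ z := by
    rw [EventuallyEq, ae_restrict_iff' hOo.measurableSet]
    filter_upwards [hz] with z h hzO
    exact h (hO hzO).2
  have hsub : O ⊆ (P.map V).support := fun z hz => (hO hz).1
  exact Measure.eqOn_open_of_ae_eq hae hOo (cτ.mono hsub) ((c₁.sub c₂).mono hsub) hpO

theorem HasEssLimitAtZero.of_mul {h f : ℝ → ℝ} {A : Set ℝ} {L I : ℝ}
    (hhf : HasEssLimitAtZero (fun r => h r * f r) A L) (hf : HasEssLimitAtZero f A I)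
    (hI : I ≠ 0) : HasEssLimitAtZero h A (L / I) := by
  unfold HasEssLimitAtZero at *
  refine (hhf.div hf hI).congr' ?_
  filter_upwards [hf.eventually_ne hI] with r hr
  rw [Pi.div_apply, mul_div_cancel_right₀ _ hr]

end BoundaryRD
-- The jump formula
theorem theorem1 {n : ℕ} {S : Type*} [MeasurableSpace S] (P : Measure S) [IsProbabilityMeasure P]
    -- the treated region
    (Ω : Set (EuclideanSpace ℝ (Fin (n + 1))))
    (hΩ_closed : IsClosed Ω) (hΩ_bdd : Bornology.IsBounded Ω)
    (hΩ_smooth : HasPiecewiseSmoothBoundary Ω)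
    -- the running vector and the potential outcomes `Y 0`, `Y 1`
    (X : S → EuclideanSpace ℝ (Fin (n + 1))) (hX : Measurable X)
    (Y : Fin 2 → S → ℝ) (hY : ∀ t, Integrable (Y t) P)
    (hX_bdd : ∃ R : ℝ, ∀ᵐ s ∂P, ‖X s‖ ≤ R)
    (hY_bdd : ∃ R : ℝ, ∀ᵐ s ∂P, |observedOutcome Ω X Y s| ≤ R)
    -- the density of the running vector
    (fX : EuclideanSpace ℝ (Fin (n + 1)) → ℝ) (hfX : IsDensity P X fX)
    (hfX_cont : ∀ x ∈ frontier Ω, ContinuousAt fX x)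
    -- the density of the signed distance is bounded away from zero near `0`
    (fg : ℝ → ℝ) (hfg : IsDensity P (fun s => signedDistance Ω (X s)) fg)
    (hfg_pos : ∃ c > 0, ∃ δ > 0, ∀ᵐ r : ℝ, |r| < δ → c ≤ fg r)
    -- the regression functions of the potential outcomes
    (m : Fin 2 → EuclideanSpace ℝ (Fin (n + 1)) → ℝ)
    (hm : ∀ t, IsRegressionFunction P (Y t) X (m t))
    (hm_smooth : ∀ t, ContDiffOn ℝ 2 (m t) (P.map X).support)
    (hm_bdd : ∀ t, ∃ C : ℝ, ∀ x ∈ (P.map X).support, |m t x| ≤ C)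
    -- the treatment effect `τ(x) = 𝔼[Y(1) - Y(0) ∣ X = x]`, in its continuous version
    (τ : EuclideanSpace ℝ (Fin (n + 1)) → ℝ)
    (hτ : IsRegressionFunction P (fun s => Y 1 s - Y 0 s) X τ)
    (hτ_cont : ContinuousOn τ (P.map X).support)
    -- any version of `r ↦ 𝔼[Y ∣ g = r]`
    (h : ℝ → ℝ)
    (hh : IsRegressionFunction P (observedOutcome Ω X Y) (fun s => signedDistance Ω (X s)) h) :
    ∃ Lplus Lminus fg0 : ℝ,
      HasEssLimitAtZero h (Ioi 0) Lplus ∧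
      HasEssLimitAtZero h (Iio 0) Lminus ∧
      HasEssLimitAtZero fg univ fg0 ∧
      0 < fg0 ∧
      fg0 = ∫ x in frontier Ω, fX x ∂μHE[n] ∧
      IntegrableOn (fun x => τ x * fX x) (frontier Ω) μHE[n] ∧
      Lplus - Lminus = (1 / fg0) * ∫ x in frontier Ω, τ x * fX x ∂μHE[n] := by
  have hΩ := hΩ_closed.measurableSet
  obtain ⟨κ, M, hκ, hin, hout⟩ := exists_isSide hΩ_closed hΩ_bdd hΩ_smooth
    (frontier_nonempty_of_isDensity hΩ hX hfg)
  have hg : Measurable fun s => signedDistance Ω (X s) := (measurable_signedDistance hΩ).comp hX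
  have hμ : (μHE[n] : Measure (EuclideanSpace ℝ (Fin (n + 1)))) (frontier Ω) ≠ ⊤ :=
    hin.control.hausdorff_ne_top hin.isCompact
  have hone : Integrable (fun _ : S => (1 : ℝ)) P := integrable_const 1
  -- the surface integral of the density
  have hfX_ae : fX =ᵐ[volume] fun x => 1 * fX x := Eventually.of_forall fun x => (one_mul _).symm
  -- The outcome 1 has regression function 1 on both X and g, so the general limit becomes that of
  -- `fg` itself.
  have hfgp := hasEssLimitAtZero_Ioi_of_regression hX hΩ hin hone hone (fun _ _ => rfl) hfX hfg
    (isRegressionFunction_one hX) (isRegressionFunction_one hg) hfX.1 hfX_cont hfX_ae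
  have hfgm := hasEssLimitAtZero_Iio_of_regression hX hΩ hout hone hone (fun _ _ => rfl) hfX hfg
    (isRegressionFunction_one hX) (isRegressionFunction_one hg) hfX.1 hfX_cont hfX_ae
  simp only [one_mul] at hfgp hfgm
  set I := ∫ x in frontier Ω, fX x ∂μHE[n] with hI
  have hI_pos : 0 < I := by
    obtain ⟨c, hc, δ, hδ, hb⟩ := hfg_pos
    -- The lower bound c passes to the limit because one-sided neighbourhoods of 0 are nontrivial
    -- modulo null sets.
    refine lt_of_lt_of_le hc (ge_of_tendsto hfgp ?_)
    refine Filter.mem_inf_of_inter (Ioo_mem_nhdsGT hδ) hb ?_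
    rintro r ⟨hr, hr'⟩
    exact hr' (by rw [abs_of_pos hr.1]; exact hr.2)
  -- the surface integrals of the density-weighted regression functions
  set ψ : Fin 2 → EuclideanSpace ℝ (Fin (n + 1)) → ℝ :=
    fun t x => (P.map X).support.indicator (m t) x * fX x with hψ
  have hψ_meas : ∀ t, Measurable (ψ t) := fun t =>
    ((hm t).1.indicator Measure.isClosed_support.measurableSet).mul hfX.1
  have hψ_cont : ∀ t, ∀ x ∈ frontier Ω, ContinuousAt (ψ t) x := fun t x hx =>
    hfX.continuousAt_indicator_support_mul (hfX_cont x hx) (hm_smooth t).continuousOn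
      (hm_bdd t).choose_spec
  have hψ_ae : ∀ t, ψ t =ᵐ[volume] fun x => m t x * fX x := fun t =>
    hfX.indicator_support_mul_ae_eq
  have hψ_int : ∀ t, IntegrableOn (ψ t) (frontier Ω) μHE[n] := fun t => by
    have : IsFiniteMeasure ((μHE[n] : Measure (EuclideanSpace ℝ (Fin (n + 1)))).restrict
        (frontier Ω)) := isFiniteMeasure_restrict.2 hμ
    obtain ⟨C, hC⟩ := hin.isCompact.exists_bound_of_continuousOn
      fun x hx => (hψ_cont t x hx).continuousWithinAt
    refine Integrable.of_bound (hψ_meas t).aestronglyMeasurable C ?_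
    exact (ae_restrict_iff' isClosed_frontier.measurableSet).2 (Eventually.of_forall hC)
  have hobs := integrable_observedOutcome hΩ hX hY
  have hp := (hasEssLimitAtZero_Ioi_of_regression hX hΩ hin hobs (hY 1)
    (fun s hs => by simp [observedOutcome, hs]) hfX hfg (hm 1) hh (hψ_meas 1) (hψ_cont 1)
    (hψ_ae 1)).of_mul hfgp hI_pos.ne'
  have hn := (hasEssLimitAtZero_Iio_of_regression hX hΩ hout hobs (hY 0)
    (fun s hs => by simp [observedOutcome, hs]) hfX hfg (hm 0) hh (hψ_meas 0) (hψ_cont 0)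
    (hψ_ae 0)).of_mul hfgm hI_pos.ne'
  have hτψ : ∀ x ∈ frontier Ω, ψ 1 x - ψ 0 x = τ x * fX x := by
    intro x hx
    -- Only where the density is positive are the versions of τ and `m` tied to each other
    -- pointwise; elsewhere both sides vanish.
    by_cases h0 : fX x = 0
    · simp [hψ, h0]
    · have hmem : x ∈ (P.map X).support :=
        mem_of_mem_nhds (hfX.support_mem_nhds (hfX_cont x hx) h0)
      simp only [hψ, indicator_of_mem hmem]
      rw [IsRegressionFunction.sub_eq_of_density_ne_zero hX (hY 1) (hY 0) hfX (hm 1) (hm 0) hτ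
        (hm_smooth 1).continuousOn (hm_smooth 0).continuousOn hτ_cont (hfX_cont x hx) h0, sub_mul]
  refine ⟨_, _, I, hp, hn, hfgp.univ_of_one_sided hfgm, hI_pos, rfl, ?_, ?_⟩
  · exact ((hψ_int 1).sub (hψ_int 0)).congr_fun hτψ isClosed_frontier.measurableSet
  · rw [← setIntegral_congr_fun isClosed_frontier.measurableSet hτψ,
      integral_sub (hψ_int 1) (hψ_int 0)]
    ring
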